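/- Consider an insurer whose surplus, before dividends, is $x+ct-\sum_{k=1}^{N_t}Y_k$ with initial capital $x$ and premium rate $c>0$. The claim sizes $Y_k$ are i.i.d. exponential with parameter $\beta>0$. The interclaim times are independent of the claim sizes and follow a phase-type distribution of order $2$: an observable phase process $J$ with phases $1,2$ and absorbing state $3$ stays in phase $i$ for an exponential time with parameter $\lambda_i=-\lambda_{ii}>0$ and then enters the state $j\neq i$, $j\in\{1,2,3\}$, with probability $\lambda_{ij}/\lambda_i$, where $\lambda_{ij}\ge 0$ for $j\ne i$, $\sum_{j=1}^3\lambda_{ij}=0$ for $i=1,2$, and both phases are transient (each of them leads to state $3$). Entering state $3$ produces a claim, after which $J$ restarts immediately in phase $i$ with probability $\pi_i$, where $\pi_1+\pi_2=1$. For barriers $b_1,b_2\ge 0$, the phase-wise barrier strategy with barriers $(b_1,b_2)$ pays out as dividends, whenever $J$ is in phase $i$, all capital above $b_i$ at once and, while the surplus equals $b_i$, all incoming premiums; below $b_i$ nothing is paid. Let $D_t$ be the resulting accumulated dividends, $\tau$ the time of ruin (the first time at which the surplus after dividends is negative), $\delta>0$ the discount factor, and $$f_i^{(b_1,b_2)}(x)=\mathbb{E}\Big[\int_{0-}^{\tau-}e^{-\delta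 t}\,\mathrm{d}D_t\,\Big|\,J_0=i,\ X_{0-}=x\Big],\qquad i=1,2.$$ Barriers $b_1^*,b_2^*\ge 0$ are called optimal if $f_i^{(b_1^*,b_2^*)}(x)\ge f_i^{(b_1,b_2)}(x)$ for all $b_1,b_2\ge 0$, for $i=1,2$ and all $0\le x<b_i^*$; write $f_i^*=f_i^{(b_1^*,b_2^*)}$. **Theorem.** If $b_1^*,b_2^*$ are optimal barriers and $0<b_1^*<b_2^*$, then $f_2^*$ is finite-valued and concave on $[b_1^*,\infty)$. -/

import Mathlib

open MeasureTheory ProbabilityTheory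

/-- A renewal risk model whose interclaim times have a phase-type distribution of order `n` and
whose claim sizes are exponentially distributed. The phases are the elements of `Fin n`. The state
`Fin.last n` is the additional absorbing state, and entering it produces a claim. -/
structure PhaseTypeRisk (n : ℕ) where
  /-- the premium rate -/
  c : ℝ
  c_pos : 0 < c
  /-- the discount factor -/
  δ : ℝ
  δ_pos : 0 < δ
  /-- the parameter of the exponential distribution of the claim sizes -/
  β : ℝ
  β_pos : 0 < β
  /-- the rows of the intensity matrix that belong to the phases -/
  rate : Matrix (Fin n) (Fin (n + 1)) ℝ
  rate_nonneg : ∀ i j, j ≠ i.castSucc → 0 ≤ rate i j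
  rate_row_sum : ∀ i, ∑ j, rate i j = 0
  rate_diag_neg : ∀ i, rate i i.castSucc < 0
  /-- every phase is transient: it leads to the absorbing state -/
  transient : ∀ i, ∃ j, Relation.ReflTransGen (fun k l : Fin n => 0 < rate k l.castSucc) i j ∧
    0 < rate j (Fin.last n)
  /-- the distribution of the phase in which the phase process restarts after a claim -/
  init : PMF (Fin n)

namespace PhaseTypeRisk

variable {n : ℕ}

/-- The parameter of the exponential time for which the phase process stays in phase `i`. -/
def exitRate (M : PhaseTypeRisk n) (i : Fin n) : ℝ := -M.rate i i.castSucc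

theorem exitRate_pos (M : PhaseTypeRisk n) (i : Fin n) : 0 < M.exitRate i :=
  neg_pos.mpr (M.rate_diag_neg i)

theorem sum_jump_eq_one (M : PhaseTypeRisk n) (i : Fin n) :
    ∑ j, (if j = i.castSucc then 0 else ENNReal.ofReal (M.rate i j / M.exitRate i)) = 1 := by
  have hpos := M.exitRate_pos i
  have h1 : ∀ j, (if j = i.castSucc then 0 else ENNReal.ofReal (M.rate i j / M.exitRate i)) =
      ENNReal.ofReal (if j = i.castSucc then 0 else M.rate i j / M.exitRate i) := by
    intro j
    split_ifs <;> simp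
  have h2 : ∀ j, 0 ≤ (if j = i.castSucc then 0 else M.rate i j / M.exitRate i) := by
    intro j
    split_ifs with h
    · exact le_rfl
    · exact div_nonneg (M.rate_nonneg i j h) hpos.le
  have h3 : ∀ j, (if j = i.castSucc then 0 else M.rate i j / M.exitRate i) =
      M.rate i j / M.exitRate i + (if j = i.castSucc then 1 else 0) := by
    intro j
    split_ifs with h
    · subst h
      have : M.rate i i.castSucc = -M.exitRate i := by simp [exitRate]
      rw [this, neg_div, div_self hpos.ne']
      ring
    · ring
  simp_rw [h1]
  rw [← ENNReal.ofReal_sum_of_nonneg (fun j _ => h2 j)]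
  simp_rw [h3]
  rw [Finset.sum_add_distrib, ← Finset.sum_div, M.rate_row_sum]
  simp

/-- The distribution of the state that the phase process enters when it leaves phase `i`. -/
noncomputable def jumpLaw (M : PhaseTypeRisk n) (i : Fin n) : PMF (Fin (n + 1)) :=
  PMF.ofFintype
    (fun j => if j = i.castSucc then 0 else ENNReal.ofReal (M.rate i j / M.exitRate i))
    (M.sum_jump_eq_one i)

/-- The randomness that is used in one stay of the phase process: for each phase `i`, the length
of the stay and the state entered afterwards in case the stay is in phase `i`; moreover, the claim
size and the new phase in case the stay ends with a claim. -/
abbrev Noise (n : ℕ) : Type := (Fin n → ℝ × Fin (n + 1)) × (ℝ × Fin n)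

/-- In phase `i` the stay is exponential with parameter `λᵢ`, and, independently, the next state is
`j` with probability `λᵢⱼ / λᵢ`; the claim size is exponential with parameter `β`; and the phase
after a claim has the distribution `π`. All of them are independent. -/
noncomputable def noiseLaw (M : PhaseTypeRisk n) : Measure (Noise n) :=
  (Measure.pi fun i => (expMeasure (M.exitRate i)).prod (M.jumpLaw i).toMeasure).prod
    ((expMeasure M.β).prod M.init.toMeasure)

instance isProbabilityMeasure_noiseLaw (M : PhaseTypeRisk n) :
    IsProbabilityMeasure M.noiseLaw := by
  have h1 : ∀ i, IsProbabilityMeasure (expMeasure (M.exitRate i)) :=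
    fun i => isProbabilityMeasure_expMeasure (M.exitRate_pos i)
  have h2 : IsProbabilityMeasure (expMeasure M.β) := isProbabilityMeasure_expMeasure M.β_pos
  unfold noiseLaw
  infer_instance

/-- The probability measure on the path space: successive stays use independent copies of the
noise. -/
noncomputable def law (M : PhaseTypeRisk n) : Measure (ℕ → Noise n) :=
  Measure.infinitePi fun _ => M.noiseLaw

/-- The phase, the starting time and the surplus at the beginning of a stay (after the claim that
may have started the stay, and before any dividend is paid in the stay). -/
abbrev Stay (n : ℕ) : Type := Fin n × ℝ × ℝ

/-- The stay that follows the stay `s` under the phase-wise barrier strategy with barriers `b`.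
During `s`, all capital above the barrier of the phase is paid out, hence the surplus is
`min (u + c * t) (b i)` when a time `t` has elapsed since the beginning of `s`, where `u` is the
surplus at the beginning and `i` is the phase. -/
noncomputable def nextStay (M : PhaseTypeRisk n) (b : Fin n → ℝ) (ξ : Noise n) (s : Stay n) :
    Stay n :=
  let i := s.1
  let duration := (ξ.1 i).1
  let target := (ξ.1 i).2
  let u := min (s.2.2 + M.c * duration) (b i)
  Fin.lastCases (motive := fun _ => Stay n)
    (ξ.2.2, s.2.1 + duration, u - ξ.2.1)
    (fun j => (j, s.2.1 + duration, u)) target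

/-- The successive stays of the phase process with initial phase `i` and initial capital `x`. -/
noncomputable def stay (M : PhaseTypeRisk n) (b : Fin n → ℝ) (i : Fin n) (x : ℝ)
    (ω : ℕ → Noise n) : ℕ → Stay n
  | 0 => (i, 0, x)
  | k + 1 => M.nextStay b (ω k) (stay M b i x ω k)

/-- The time of ruin. Between two jumps the surplus does not become negative if it is nonnegative
at the first one, so only the surplus at the beginnings of the stays matters. -/
noncomputable def ruinTime (M : PhaseTypeRisk n) (b : Fin n → ℝ) (i : Fin n) (x : ℝ)
    (ω : ℕ → Noise n) : EReal :=
  ⨅ (k : ℕ) (_ : (M.stay b i x ω k).2.2 < 0), ((M.stay b i x ω k).2.1 : EReal)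

/-- The dividends paid in a stay `s` that ends at time `e`, as a measure on the time axis: the
capital above the barrier is paid as a lump sum at the beginning of the stay, and the premiums are
paid out while the surplus is at the barrier. -/
noncomputable def stayDividends (M : PhaseTypeRisk n) (b : Fin n → ℝ) (s : Stay n) (e : ℝ) :
    Measure ℝ :=
  ENNReal.ofReal (s.2.2 - b s.1) • Measure.dirac s.2.1 +
    ENNReal.ofReal M.c •
      volume.restrict {t | t ∈ Set.Ico s.2.1 e ∧ b s.1 ≤ s.2.2 + M.c * (t - s.2.1)}

/-- The dividend measure `dD` of the phase-wise barrier strategy with barriers `b`; the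
accumulated dividend process is `D_t = dD [0, t)`. -/
noncomputable def dividends (M : PhaseTypeRisk n) (b : Fin n → ℝ) (i : Fin n) (x : ℝ)
    (ω : ℕ → Noise n) : Measure ℝ :=
  Measure.sum fun k => M.stayDividends b (M.stay b i x ω k) (M.stay b i x ω (k + 1)).2.1

/-- The expected discounted dividends until ruin, `𝔼[∫_{[0, τ)} e^{-δ t} dD_t]`, of the phase-wise
barrier strategy with barriers `b`, for initial phase `i` and initial capital `x`. -/
noncomputable def expectedDividends (M : PhaseTypeRisk n) (b : Fin n → ℝ) (i : Fin n) (x : ℝ) :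
    ENNReal :=
  ∫⁻ ω, ∫⁻ t in {t : ℝ | (t : EReal) < M.ruinTime b i x ω},
    ENNReal.ofReal (Real.exp (-M.δ * t)) ∂(M.dividends b i x ω) ∂M.law

/-- The value function of the phase-wise barrier strategy with barriers `b` in phase `i`. -/
noncomputable def value (M : PhaseTypeRisk n) (b : Fin n → ℝ) (i : Fin n) (x : ℝ) : ℝ :=
  (M.expectedDividends b i x).toReal

/-- The barriers `b` are optimal: among all phase-wise barrier strategies, the one with barriers
`b` has maximal expected discounted dividends in each phase `i`, for every initial capital below
the barrier `b i`. -/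
def IsOptimalBarrier (M : PhaseTypeRisk n) (b : Fin n → ℝ) : Prop :=
  (∀ i, 0 ≤ b i) ∧ ∀ b' : Fin n → ℝ, (∀ i, 0 ≤ b' i) → ∀ i x, 0 ≤ x → x < b i →
    M.expectedDividends b' i x ≤ M.expectedDividends b i x

end PhaseTypeRisk

namespace PhaseTypeRisk

variable {n : ℕ}

/-! ### Path space and the shift by one stay -/

instance isProbabilityMeasure_law (M : PhaseTypeRisk n) : IsProbabilityMeasure M.law := by
  unfold law
  infer_instance

/-- The law of the path splits into the first noise variable and the shifted path. -/
theorem measurePreserving_cons (M : PhaseTypeRisk n) :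
    MeasurePreserving (fun p : Noise n × (ℕ → Noise n) => fun k : ℕ =>
      Nat.casesOn (motive := fun _ => Noise n) k p.1 p.2) (M.noiseLaw.prod M.law) M.law := by
  have hmeas : Measurable (fun p : Noise n × (ℕ → Noise n) => fun k : ℕ =>
      Nat.casesOn (motive := fun _ => Noise n) k p.1 p.2) := by
    refine measurable_pi_lambda _ fun k => ?_
    cases k with
    | zero => exact measurable_fst
    | succ k => exact (measurable_pi_apply k).comp measurable_snd
  refine ⟨hmeas, ?_⟩
  refine Measure.eq_infinitePi _ fun s t ht => ?_
  classical
  have hinj : Set.InjOn Nat.succ (Nat.succ ⁻¹' (s : Set ℕ)) := Nat.succ_injective.injOn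
  have hpre : (fun p : Noise n × (ℕ → Noise n) => fun k : ℕ =>
      Nat.casesOn (motive := fun _ => Noise n) k p.1 p.2) ⁻¹' (Set.pi s t) =
      (if 0 ∈ s then t 0 else Set.univ) ×ˢ
        Set.pi (s.preimage Nat.succ hinj) (fun k => t (k + 1)) := by
    ext ⟨ξ, ω⟩
    simp only [Set.mem_preimage, Set.mem_pi, Finset.mem_coe, Set.mem_prod, Finset.mem_preimage]
    constructor
    · intro h
      refine ⟨?_, fun k hk => h (k + 1) hk⟩
      split_ifs with h0
      · exact h 0 h0
      · trivial
    · rintro ⟨h0, h1⟩ k hk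
      cases k with
      | zero => simpa [hk] using h0
      | succ k => exact h1 k hk
  rw [Measure.map_apply hmeas (MeasurableSet.pi s.countable_toSet fun i _ => ht i), hpre,
    Measure.prod_prod, law, Measure.infinitePi_pi _ (fun i _ => ht (i + 1))]
  -- The factor at `0`, the only index that is not a successor, is set to 1 so that the product over
  -- the preimage becomes a product over all of `s`.
  have hprod := Finset.prod_preimage Nat.succ s hinj (fun k => if k = 0 then 1 else M.noiseLaw (t k))
    (by intro k _ hk; cases k with
      | zero => simp
      | succ k => exact absurd ⟨k, rfl⟩ hk)
  simp only [Nat.succ_eq_add_one, Nat.add_eq_zero_iff, one_ne_zero, and_false, if_false] at hprod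
  rw [hprod]
  split_ifs with h0
  · rw [← Finset.mul_prod_erase s _ h0, ← Finset.mul_prod_erase s (fun k => M.noiseLaw (t k)) h0]
    simp only [if_true, one_mul]
    congr 1
    refine Finset.prod_congr rfl fun k hk => ?_
    simp [(Finset.mem_erase.mp hk).1]
  · simp only [measure_univ, one_mul]
    refine Finset.prod_congr rfl fun k hk => ?_
    rw [if_neg]
    rintro rfl
    exact h0 hk

theorem nextStay_time (M : PhaseTypeRisk n) (b : Fin n → ℝ) (ξ : Noise n) (s : Stay n) :
    (M.nextStay b ξ s).2.1 = s.2.1 + (ξ.1 s.1).1 := by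
  unfold nextStay
  dsimp only
  induction (ξ.1 s.1).2 using Fin.lastCases <;> simp

theorem nextStay_add_time (M : PhaseTypeRisk n) (b : Fin n → ℝ) (ξ : Noise n) (i : Fin n)
    (r t u : ℝ) :
    M.nextStay b ξ (i, r + t, u) =
      ((M.nextStay b ξ (i, t, u)).1, r + (M.nextStay b ξ (i, t, u)).2.1,
        (M.nextStay b ξ (i, t, u)).2.2) := by
  unfold nextStay
  dsimp only
  induction (ξ.1 i).2 using Fin.lastCases <;> simp [add_assoc]

/-- Renewal at the end of the first stay: the dynamics do not depend on the clock, so the remaining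
path is a fresh one driven by the shifted noise, with all times delayed by the first duration. -/
theorem stay_succ_eq_shift (M : PhaseTypeRisk n) (b : Fin n → ℝ) (i : Fin n) (x : ℝ)
    (ω : ℕ → Noise n) (k : ℕ) :
    M.stay b i x ω (k + 1) =
      ((M.stay b (M.nextStay b (ω 0) (i, 0, x)).1 (M.nextStay b (ω 0) (i, 0, x)).2.2
          (fun m => ω (m + 1)) k).1,
        ((ω 0).1 i).1 + (M.stay b (M.nextStay b (ω 0) (i, 0, x)).1
          (M.nextStay b (ω 0) (i, 0, x)).2.2 (fun m => ω (m + 1)) k).2.1,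
        (M.stay b (M.nextStay b (ω 0) (i, 0, x)).1 (M.nextStay b (ω 0) (i, 0, x)).2.2
          (fun m => ω (m + 1)) k).2.2) := by
  induction k with
  | zero =>
    have h := M.nextStay_time b (ω 0) (i, 0, x)
    simp only [stay]
    ext <;> simp [h]
  | succ k ih =>
    rw [stay, ih, nextStay_add_time]
    simp only [stay, Prod.mk.eta]

theorem nextStay_surplus_le (M : PhaseTypeRisk n) {b : Fin n → ℝ} {B : ℝ} (hB : ∀ i, b i ≤ B)
    (ξ : Noise n) (s : Stay n) (hξ : 0 ≤ ξ.2.1) : (M.nextStay b ξ s).2.2 ≤ B := by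
  have h : min (s.2.2 + M.c * (ξ.1 s.1).1) (b s.1) ≤ B := (min_le_right _ _).trans (hB _)
  unfold nextStay
  dsimp only
  induction (ξ.1 s.1).2 using Fin.lastCases with
  | last => rw [Fin.lastCases_last]; dsimp only; linarith
  | cast j => rw [Fin.lastCases_castSucc]; exact h

theorem measurable_nextStay (M : PhaseTypeRisk n) (b : Fin n → ℝ) (i : Fin n) :
    Measurable (fun p : ℝ × Noise n => M.nextStay b p.2 (i, 0, p.1)) := by
  have h : Measurable (fun q : Fin (n + 1) × (ℝ × Noise n) =>
      Fin.lastCases (motive := fun _ => Stay n)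
        (q.2.2.2.2, 0 + (q.2.2.1 i).1, min (q.2.1 + M.c * (q.2.2.1 i).1) (b i) - q.2.2.2.1)
        (fun j => (j, 0 + (q.2.2.1 i).1, min (q.2.1 + M.c * (q.2.2.1 i).1) (b i))) q.1) := by
    refine measurable_from_prod_countable_right fun j => ?_
    induction j using Fin.lastCases with
    | last => simp only [Fin.lastCases_last]; fun_prop
    | cast j => simp only [Fin.lastCases_castSucc]; fun_prop
  have h2 : Measurable (fun p : ℝ × Noise n => ((p.2.1 i).2, p)) := by fun_prop
  exact h.comp h2

/-! ### Dividends stay by stay and the first-step equation -/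

/-- The dividends paid during a stay of length `T` that begins in phase `i` with surplus `u`,
discounted to the beginning of the stay. -/
noncomputable def reward (M : PhaseTypeRisk n) (b : Fin n → ℝ) (i : Fin n) (u T : ℝ) : ENNReal :=
  ENNReal.ofReal (u - b i) + ENNReal.ofReal M.c *
    ∫⁻ s in {s | s ∈ Set.Ico 0 T ∧ b i ≤ u + M.c * s}, ENNReal.ofReal (Real.exp (-M.δ * s))

theorem measurable_reward (M : PhaseTypeRisk n) (b : Fin n → ℝ) (i : Fin n) :
    Measurable (fun p : ℝ × ℝ => M.reward b i p.1 p.2) := by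
  unfold reward
  refine Measurable.add (ENNReal.measurable_ofReal.comp (by fun_prop)) (Measurable.const_mul ?_ _)
  have h : MeasurableSet {q : (ℝ × ℝ) × ℝ | q.2 ∈ Set.Ico 0 q.1.2 ∧ b i ≤ q.1.1 + M.c * q.2} := by
    have : {q : (ℝ × ℝ) × ℝ | q.2 ∈ Set.Ico 0 q.1.2 ∧ b i ≤ q.1.1 + M.c * q.2} =
      {q | (0:ℝ) ≤ q.2} ∩ {q | q.2 < q.1.2} ∩ {q | b i ≤ q.1.1 + M.c * q.2} := by
      ext q; simp [Set.mem_Ico]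
    rw [this]
    exact ((measurableSet_le measurable_const measurable_snd).inter
      (measurableSet_lt measurable_snd (by fun_prop))).inter
      (measurableSet_le measurable_const (by fun_prop))
  have h2 : Measurable (fun q : (ℝ × ℝ) × ℝ =>
      {q : (ℝ × ℝ) × ℝ | q.2 ∈ Set.Ico 0 q.1.2 ∧ b i ≤ q.1.1 + M.c * q.2}.indicator
        (fun q => ENNReal.ofReal (Real.exp (-M.δ * q.2))) q) :=
    Measurable.indicator (by fun_prop) h
  convert h2.lintegral_prod_right' (ν := volume) using 2 with p
  rw [← lintegral_indicator]
  · rfl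
  · exact measurable_prodMk_left h

/-- The expected discounted dividends if the current stay is followed by the reward `v`. -/
noncomputable def stepOp (M : PhaseTypeRisk n) (b : Fin n → ℝ) (v : Fin n → ℝ → ENNReal)
    (i : Fin n) (x : ℝ) : ENNReal :=
  ∫⁻ ξ, (if 0 ≤ x then M.reward b i x (ξ.1 i).1 + ENNReal.ofReal (Real.exp (-M.δ * (ξ.1 i).1)) *
    v (M.nextStay b ξ (i, 0, x)).1 (M.nextStay b ξ (i, 0, x)).2.2 else 0) ∂M.noiseLaw

/-- The dividends paid before ruin in the `k`-th stay, discounted to time `0`. -/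
noncomputable def term (M : PhaseTypeRisk n) (b : Fin n → ℝ) :
    ℕ → Fin n → ℝ → (ℕ → Noise n) → ENNReal
  | 0, i, x, ω => if 0 ≤ x then M.reward b i x ((ω 0).1 i).1 else 0
  | k + 1, i, x, ω => if 0 ≤ x then ENNReal.ofReal (Real.exp (-M.δ * ((ω 0).1 i).1)) *
      term M b k (M.nextStay b (ω 0) (i, 0, x)).1 (M.nextStay b (ω 0) (i, 0, x)).2.2
        (fun m => ω (m + 1)) else 0

theorem measurable_term (M : PhaseTypeRisk n) (b : Fin n → ℝ) (k : ℕ) (i : Fin n) :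
    Measurable (fun p : ℝ × (ℕ → Noise n) => M.term b k i p.1 p.2) := by
  induction k generalizing i with
  | zero =>
    simp only [term]
    refine Measurable.ite (measurableSet_le (by fun_prop) (by fun_prop)) ?_ (by fun_prop)
    exact (M.measurable_reward b i).comp
      (g := fun p : ℝ × ℝ => M.reward b i p.1 p.2)
      (f := fun p : ℝ × (ℕ → Noise n) => (p.1, ((p.2 0).1 i).1)) (by fun_prop)
  | succ k ih =>
    simp only [term]
    refine Measurable.ite (measurableSet_le (by fun_prop) (by fun_prop)) ?_ (by fun_prop)
    refine Measurable.mul (by fun_prop) ?_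
    have h1 : Measurable (fun q : Fin n × (ℝ × (ℕ → Noise n)) => M.term b k q.1 q.2.1 q.2.2) :=
      measurable_from_prod_countable_right ih
    have h2 : Measurable (fun p : ℝ × (ℕ → Noise n) => M.nextStay b (p.2 0) (i, 0, p.1)) :=
      (M.measurable_nextStay b i).comp
        (f := fun p : ℝ × (ℕ → Noise n) => (p.1, p.2 0)) (by fun_prop)
    have h3 : Measurable (fun p : ℝ × (ℕ → Noise n) => ((M.nextStay b (p.2 0) (i, 0, p.1)).1,
        ((M.nextStay b (p.2 0) (i, 0, p.1)).2.2, fun m => p.2 (m + 1)))) :=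
      h2.fst.prodMk (h2.snd.snd.prodMk (by fun_prop))
    exact h1.comp h3

theorem measurable_term_path (M : PhaseTypeRisk n) (b : Fin n → ℝ) (k : ℕ) (i : Fin n) (x : ℝ) :
    Measurable (M.term b k i x) :=
  (M.measurable_term b k i).comp measurable_prodMk_left

theorem measurable_reward_noise (M : PhaseTypeRisk n) (b : Fin n → ℝ) (i : Fin n) (x : ℝ) :
    Measurable (fun ξ : Noise n => M.reward b i x (ξ.1 i).1) :=
  (M.measurable_reward b i).comp (f := fun ξ : Noise n => (x, (ξ.1 i).1)) (by fun_prop)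

theorem term_eq (M : PhaseTypeRisk n) (b : Fin n → ℝ) (k : ℕ) (i : Fin n) (x : ℝ)
    (ω : ℕ → Noise n) (h : ∀ j ≤ k, 0 ≤ (M.stay b i x ω j).2.2) :
    M.term b k i x ω = ENNReal.ofReal (Real.exp (-M.δ * (M.stay b i x ω k).2.1)) *
      M.reward b (M.stay b i x ω k).1 (M.stay b i x ω k).2.2
        ((ω k).1 (M.stay b i x ω k).1).1 := by
  induction k generalizing i x ω with
  | zero =>
    have h0 : 0 ≤ x := h 0 le_rfl
    simp [term, stay, h0]
  | succ k ih =>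
    have h0 : 0 ≤ x := h 0 (Nat.zero_le _)
    rw [term, if_pos h0, ih, ← mul_assoc, ← ENNReal.ofReal_mul (Real.exp_nonneg _), ← Real.exp_add,
      stay_succ_eq_shift, ← mul_add]
    intro j hj
    have := h (j + 1) (by omega)
    rwa [stay_succ_eq_shift] at this

theorem term_eq_zero (M : PhaseTypeRisk n) (b : Fin n → ℝ) (k : ℕ) (i : Fin n) (x : ℝ)
    (ω : ℕ → Noise n) (h : ∃ j ≤ k, (M.stay b i x ω j).2.2 < 0) : M.term b k i x ω = 0 := by
  induction k generalizing i x ω with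
  | zero =>
    obtain ⟨j, hj, hneg⟩ := h
    obtain rfl : j = 0 := by omega
    have h0 : x < 0 := hneg
    simp [term, h0.not_ge]
  | succ k ih =>
    obtain ⟨j, hj, hneg⟩ := h
    rw [term]
    split_ifs with h0
    · cases j with
      | zero => exact absurd hneg h0.not_gt
      | succ j =>
        rw [ih, mul_zero]
        refine ⟨j, by omega, ?_⟩
        rwa [stay_succ_eq_shift] at hneg
    · rfl

theorem lintegral_stayDividends (M : PhaseTypeRisk n) (b : Fin n → ℝ) (s : Stay n) (T : ℝ) :
    ∫⁻ t, ENNReal.ofReal (Real.exp (-M.δ * t)) ∂(M.stayDividends b s (s.2.1 + T)) =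
      ENNReal.ofReal (Real.exp (-M.δ * s.2.1)) * M.reward b s.1 s.2.2 T := by
  have hset : ∀ r : ℝ, MeasurableSet
      {t | t ∈ Set.Ico r (r + T) ∧ b s.1 ≤ s.2.2 + M.c * (t - r)} := fun r =>
    measurableSet_Ico.inter (measurableSet_le (f := fun _ => b s.1) measurable_const (by fun_prop))
  have hset0 : MeasurableSet {t | t ∈ Set.Ico 0 T ∧ b s.1 ≤ s.2.2 + M.c * t} :=
    measurableSet_Ico.inter (measurableSet_le (f := fun _ => b s.1) measurable_const (by fun_prop))
  rw [stayDividends, lintegral_add_measure, lintegral_smul_measure, lintegral_smul_measure,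
    lintegral_dirac' _ (by fun_prop), reward, mul_add, smul_eq_mul, smul_eq_mul, mul_comm]
  congr 1
  rw [mul_left_comm]
  congr 1
  rw [← lintegral_const_mul _ (by fun_prop), ← lintegral_indicator (hset _),
    ← lintegral_indicator hset0, ← lintegral_add_right_eq_self _ s.2.1]
  refine lintegral_congr fun t => ?_
  have hiff : t + s.2.1 ∈ {t | t ∈ Set.Ico s.2.1 (s.2.1 + T) ∧
      b s.1 ≤ s.2.2 + M.c * (t - s.2.1)} ↔ t ∈ {t | t ∈ Set.Ico 0 T ∧ b s.1 ≤ s.2.2 + M.c * t} := by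
    simp [add_comm t]
  by_cases ht : t ∈ {t | t ∈ Set.Ico 0 T ∧ b s.1 ≤ s.2.2 + M.c * t}
  · rw [Set.indicator_of_mem ht, Set.indicator_of_mem (hiff.mpr ht),
      ← ENNReal.ofReal_mul (Real.exp_nonneg _), ← Real.exp_add]
    congr 2
    ring
  · rw [Set.indicator_of_notMem ht, Set.indicator_of_notMem (fun h => ht (hiff.mp h))]

theorem stayDividends_compl (M : PhaseTypeRisk n) (b : Fin n → ℝ) (s : Stay n) {e : ℝ}
    (he : s.2.1 < e) : M.stayDividends b s e (Set.Ico s.2.1 e)ᶜ = 0 := by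
  have h : {t | t ∈ Set.Ico s.2.1 e ∧ b s.1 ≤ s.2.2 + M.c * (t - s.2.1)} ⊆ Set.Ico s.2.1 e :=
    fun t ht => ht.1
  have h2 : (volume.restrict {t | t ∈ Set.Ico s.2.1 e ∧ b s.1 ≤ s.2.2 + M.c * (t - s.2.1)})
      (Set.Ico s.2.1 e)ᶜ = 0 := by
    rw [Measure.restrict_apply measurableSet_Ico.compl]
    convert measure_empty (μ := volume)
    ext t
    simp only [Set.mem_inter_iff, Set.mem_compl_iff, Set.mem_empty_iff_false, iff_false, not_and]
    exact fun h1 h3 => h1 (h h3)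
  rw [stayDividends, Measure.add_apply, Measure.smul_apply, Measure.smul_apply, h2,
    Measure.dirac_apply' _ measurableSet_Ico.compl]
  simp [he]

/-- Ruin can only happen at the beginning of a stay, and the dividends of a stay live on the
half-open interval from its beginning to its end. So a stay counts fully or not at all, according to
whether some surplus up to its beginning was negative. -/
theorem lintegral_before_ruin_stayDividends (M : PhaseTypeRisk n) (b : Fin n → ℝ) (i : Fin n)
    (x : ℝ) (ω : ℕ → Noise n) (hω : ∀ k i, 0 < ((ω k).1 i).1) (k : ℕ) :
    ∫⁻ t in {t : ℝ | (t : EReal) < M.ruinTime b i x ω}, ENNReal.ofReal (Real.exp (-M.δ * t))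
      ∂(M.stayDividends b (M.stay b i x ω k) (M.stay b i x ω (k + 1)).2.1) = M.term b k i x ω := by
  have hstep : ∀ k, (M.stay b i x ω (k + 1)).2.1 =
      (M.stay b i x ω k).2.1 + ((ω k).1 (M.stay b i x ω k).1).1 := fun k => by
    rw [stay, nextStay_time]
  have hmono : StrictMono fun k => (M.stay b i x ω k).2.1 := strictMono_nat_of_lt_succ fun k => by
    rw [hstep k]; linarith [hω k (M.stay b i x ω k).1]
  have hcompl := M.stayDividends_compl b (M.stay b i x ω k) (hmono (Nat.lt_succ_self k))
  by_cases h : ∃ j ≤ k, (M.stay b i x ω j).2.2 < 0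
  · rw [M.term_eq_zero b k i x ω h]
    obtain ⟨j, hj, hneg⟩ := h
    have hτ : M.ruinTime b i x ω ≤ ((M.stay b i x ω k).2.1 : EReal) :=
      (iInf₂_le j hneg).trans (by exact_mod_cast hmono.monotone hj)
    refine setLIntegral_measure_zero _ _ (measure_mono_null ?_ hcompl)
    intro t ht hmem
    exact absurd (lt_of_lt_of_le ht hτ) (not_lt.mpr (by exact_mod_cast hmem.1))
  · push Not at h
    rw [M.term_eq b k i x ω h, ← M.lintegral_stayDividends, ← hstep]
    refine (setLIntegral_congr ?_).trans (setLIntegral_univ _)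
    refine ae_eq_univ.mpr (measure_mono_null ?_ hcompl)
    intro t ht hmem
    refine ht ?_
    have hτ : ((M.stay b i x ω (k + 1)).2.1 : EReal) ≤ M.ruinTime b i x ω := by
      refine le_iInf₂ fun j hj => ?_
      have : k + 1 ≤ j := by
        by_contra hlt
        exact absurd hj (not_lt.mpr (h j (by omega)))
      exact_mod_cast hmono.monotone this
    exact lt_of_lt_of_le (by exact_mod_cast hmem.2) hτ

theorem ae_expMeasure_pos {r : ℝ} : ∀ᵐ x ∂(expMeasure r), 0 < x := by
  rw [ae_iff]
  have : {x : ℝ | ¬ 0 < x} = Set.Iic 0 := by ext; simp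
  rw [this, expMeasure, gammaMeasure, withDensity_apply _ measurableSet_Iic]
  exact lintegral_exponentialPDF_of_nonpos (r := r) le_rfl |> fun h => by
    rw [← h]
    exact setLIntegral_congr Iio_ae_eq_Iic.symm

theorem ae_noiseLaw_duration_pos (M : PhaseTypeRisk n) (i : Fin n) :
    ∀ᵐ ξ ∂M.noiseLaw, 0 < (ξ.1 i).1 := by
  have h1 : ∀ i, IsProbabilityMeasure (expMeasure (M.exitRate i)) :=
    fun i => isProbabilityMeasure_expMeasure (M.exitRate_pos i)
  have h2 : IsProbabilityMeasure (expMeasure M.β) := isProbabilityMeasure_expMeasure M.β_pos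
  have e1 := Measure.quasiMeasurePreserving_fst (μ := Measure.pi fun i =>
    (expMeasure (M.exitRate i)).prod (M.jumpLaw i).toMeasure)
    (ν := (expMeasure M.β).prod M.init.toMeasure)
  have e2 := (measurePreserving_eval (fun i => (expMeasure (M.exitRate i)).prod
    (M.jumpLaw i).toMeasure) i).quasiMeasurePreserving
  have e3 := Measure.quasiMeasurePreserving_fst (μ := expMeasure (M.exitRate i))
    (ν := (M.jumpLaw i).toMeasure)
  exact ((e3.comp e2).comp e1).ae ae_expMeasure_pos

theorem ae_noiseLaw_claim_pos (M : PhaseTypeRisk n) : ∀ᵐ ξ ∂M.noiseLaw, 0 < ξ.2.1 := by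
  have h1 : ∀ i, IsProbabilityMeasure (expMeasure (M.exitRate i)) :=
    fun i => isProbabilityMeasure_expMeasure (M.exitRate_pos i)
  have h2 : IsProbabilityMeasure (expMeasure M.β) := isProbabilityMeasure_expMeasure M.β_pos
  have e1 := Measure.quasiMeasurePreserving_snd (μ := Measure.pi fun i =>
    (expMeasure (M.exitRate i)).prod (M.jumpLaw i).toMeasure)
    (ν := (expMeasure M.β).prod M.init.toMeasure)
  have e3 := Measure.quasiMeasurePreserving_fst (μ := expMeasure M.β) (ν := M.init.toMeasure)
  exact (e3.comp e1).ae ae_expMeasure_pos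

theorem ae_law_duration_pos (M : PhaseTypeRisk n) :
    ∀ᵐ ω ∂M.law, ∀ k i, 0 < ((ω k).1 i).1 := by
  rw [ae_all_iff]
  intro k
  rw [ae_all_iff]
  intro i
  exact (measurePreserving_eval_infinitePi (fun _ => M.noiseLaw) k).quasiMeasurePreserving.ae
    (M.ae_noiseLaw_duration_pos i)

theorem measurable_lintegral_term (M : PhaseTypeRisk n) (b : Fin n → ℝ) (k : ℕ) (i : Fin n) :
    Measurable (fun x => ∫⁻ ω, M.term b k i x ω ∂M.law) := by
  exact (M.measurable_term b k i).lintegral_prod_right'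

theorem expectedDividends_eq_tsum (M : PhaseTypeRisk n) (b : Fin n → ℝ) (i : Fin n) (x : ℝ) :
    M.expectedDividends b i x = ∑' k, ∫⁻ ω, M.term b k i x ω ∂M.law := by
  rw [← lintegral_tsum fun k => (M.measurable_term_path b k i x).aemeasurable]
  refine lintegral_congr_ae ?_
  filter_upwards [M.ae_law_duration_pos] with ω hω
  rw [dividends, Measure.restrict_sum_of_countable, lintegral_sum_measure]
  exact tsum_congr fun k => M.lintegral_before_ruin_stayDividends b i x ω hω k

theorem measurable_expectedDividends (M : PhaseTypeRisk n) (b : Fin n → ℝ) (i : Fin n) :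
    Measurable (M.expectedDividends b i) := by
  simp only [funext (M.expectedDividends_eq_tsum b i)]
  exact Measurable.tsum fun k => M.measurable_lintegral_term b k i

theorem measurable_comp_nextStay (M : PhaseTypeRisk n) (b : Fin n → ℝ) {v : Fin n → ℝ → ENNReal}
    (hv : ∀ i, Measurable (v i)) (i : Fin n) (x : ℝ) : Measurable (fun ξ : Noise n =>
      v (M.nextStay b ξ (i, 0, x)).1 (M.nextStay b ξ (i, 0, x)).2.2) := by
  have h1 : Measurable (fun q : Fin n × ℝ => v q.1 q.2) := measurable_from_prod_countable_right hv
  have h2 : Measurable (fun ξ : Noise n => M.nextStay b ξ (i, 0, x)) :=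
    (M.measurable_nextStay b i).comp measurable_prodMk_left
  exact h1.comp (h2.fst.prodMk h2.snd.snd)

theorem lintegral_term_zero (M : PhaseTypeRisk n) (b : Fin n → ℝ) (i : Fin n) (x : ℝ) :
    ∫⁻ ω, M.term b 0 i x ω ∂M.law =
      ∫⁻ ξ, (if 0 ≤ x then M.reward b i x (ξ.1 i).1 else 0) ∂M.noiseLaw := by
  have h : Measurable (fun ξ : Noise n => if 0 ≤ x then M.reward b i x (ξ.1 i).1 else 0) := by
    split_ifs
    · exact M.measurable_reward_noise b i x
    · fun_prop
  exact (measurePreserving_eval_infinitePi (fun _ => M.noiseLaw) 0).lintegral_comp h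

theorem lintegral_term_succ (M : PhaseTypeRisk n) (b : Fin n → ℝ) (k : ℕ) (i : Fin n) (x : ℝ) :
    ∫⁻ ω, M.term b (k + 1) i x ω ∂M.law =
      ∫⁻ ξ, (if 0 ≤ x then ENNReal.ofReal (Real.exp (-M.δ * (ξ.1 i).1)) *
        ∫⁻ ω, M.term b k (M.nextStay b ξ (i, 0, x)).1 (M.nextStay b ξ (i, 0, x)).2.2 ω ∂M.law
        else 0) ∂M.noiseLaw := by
  have hm := M.measurable_term_path b (k + 1) i x
  rw [← M.measurePreserving_cons.lintegral_comp hm]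
  refine (lintegral_prod _ (hm.comp M.measurePreserving_cons.measurable).aemeasurable).trans ?_
  refine lintegral_congr fun ξ => ?_
  simp only [Function.comp_apply, term]
  split_ifs
  · exact lintegral_const_mul (ENNReal.ofReal (Real.exp (-M.δ * (ξ.1 i).1)))
      (M.measurable_term_path b k (M.nextStay b ξ (i, 0, x)).1 (M.nextStay b ξ (i, 0, x)).2.2)
  · simp

/-- The first-step equation. -/
theorem stepOp_expectedDividends (M : PhaseTypeRisk n) (b : Fin n → ℝ) (i : Fin n) (x : ℝ) :
    M.stepOp b (M.expectedDividends b) i x = M.expectedDividends b i x := by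
  rw [expectedDividends_eq_tsum, tsum_eq_zero_add' ENNReal.summable, lintegral_term_zero]
  simp_rw [lintegral_term_succ]
  rw [stepOp]
  split_ifs with hx
  · rw [lintegral_add_left (M.measurable_reward_noise b i x),
      ← lintegral_tsum fun k => (Measurable.fun_mul
        (f := fun ξ : Noise n => ENNReal.ofReal (Real.exp (-M.δ * (ξ.1 i).1))) (by fun_prop)
        (M.measurable_comp_nextStay b (M.measurable_lintegral_term b k) i x)).aemeasurable]
    simp_rw [expectedDividends_eq_tsum, ENNReal.tsum_mul_left]
  · simp

/-! ### Discounting, linear growth and finiteness -/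

theorem exists_discount (M : PhaseTypeRisk n) : ∃ ρ < (1 : ENNReal), ∀ i,
    ∫⁻ ξ, ENNReal.ofReal (Real.exp (-M.δ * (ξ.1 i).1)) ∂M.noiseLaw ≤ ρ := by
  refine ⟨Finset.univ.sup fun i =>
    ∫⁻ ξ, ENNReal.ofReal (Real.exp (-M.δ * (ξ.1 i).1)) ∂M.noiseLaw, ?_, fun i =>
    Finset.le_sup (f := fun i => ∫⁻ ξ, ENNReal.ofReal (Real.exp (-M.δ * (ξ.1 i).1)) ∂M.noiseLaw)
      (Finset.mem_univ i)⟩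
  refine (Finset.sup_lt_iff (by simp)).mpr fun i _ => ?_
  have hlt : ∀ᵐ ξ ∂M.noiseLaw, ENNReal.ofReal (Real.exp (-M.δ * (ξ.1 i).1)) < 1 := by
    filter_upwards [M.ae_noiseLaw_duration_pos i] with ξ hξ
    rw [ENNReal.ofReal_lt_one, Real.exp_lt_one_iff]
    nlinarith [mul_pos M.δ_pos hξ]
  have h1 : ∫⁻ _ : Noise n, (1 : ENNReal) ∂M.noiseLaw = 1 := by simp
  rw [← h1]
  refine lintegral_strict_mono (IsProbabilityMeasure.ne_zero _) (by fun_prop) ?_ hlt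
  refine ne_top_of_le_ne_top (b := 1) (by simp) ?_
  rw [← h1]
  exact lintegral_mono_ae (hlt.mono fun _ h => h.le)

theorem stepOp_mono (M : PhaseTypeRisk n) (b : Fin n → ℝ) {v w : Fin n → ℝ → ENNReal}
    (h : ∀ i x, v i x ≤ w i x) (i : Fin n) (x : ℝ) : M.stepOp b v i x ≤ M.stepOp b w i x := by
  refine lintegral_mono fun ξ => ?_
  dsimp only
  split_ifs
  · gcongr
    exact h _ _
  · exact le_rfl

/-- The contraction property in one-sided form, which avoids subtraction in `ENNReal`: an additive
error shrinks by the factor ρ. -/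
theorem stepOp_add_const_le (M : PhaseTypeRisk n) (b : Fin n → ℝ) {v : Fin n → ℝ → ENNReal}
    {ρ : ENNReal} (hρ : ∀ i, ∫⁻ ξ, ENNReal.ofReal (Real.exp (-M.δ * (ξ.1 i).1)) ∂M.noiseLaw ≤ ρ)
    (K : ENNReal) (i : Fin n) (x : ℝ) :
    M.stepOp b (fun j y => v j y + K) i x ≤ M.stepOp b v i x + ρ * K := by
  have hm : Measurable fun ξ : Noise n => ENNReal.ofReal (Real.exp (-M.δ * (ξ.1 i).1)) * K := by
    fun_prop
  calc M.stepOp b (fun j y => v j y + K) i x ≤ ∫⁻ ξ, ((if 0 ≤ x then M.reward b i x (ξ.1 i).1 +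
        ENNReal.ofReal (Real.exp (-M.δ * (ξ.1 i).1)) *
          v (M.nextStay b ξ (i, 0, x)).1 (M.nextStay b ξ (i, 0, x)).2.2 else 0) +
        ENNReal.ofReal (Real.exp (-M.δ * (ξ.1 i).1)) * K) ∂M.noiseLaw := by
        refine lintegral_mono fun ξ => ?_
        dsimp only
        split_ifs
        · rw [mul_add, add_assoc]
        · exact zero_le
    _ = M.stepOp b v i x + (∫⁻ ξ, ENNReal.ofReal (Real.exp (-M.δ * (ξ.1 i).1)) ∂M.noiseLaw) * K := by
        rw [lintegral_add_right _ hm, lintegral_mul_const _ (by fun_prop), stepOp]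
    _ ≤ _ := by gcongr; exact hρ i

theorem lintegral_exp_Ici {q : ℝ} (hq : 0 < q) (a : ℝ) :
    ∫⁻ s in Set.Ici a, ENNReal.ofReal (Real.exp (-q * s)) =
      ENNReal.ofReal (Real.exp (-q * a) / q) := by
  rw [setLIntegral_congr Ioi_ae_eq_Ici.symm, ← ofReal_integral_eq_lintegral_ofReal
    (integrableOn_exp_mul_Ioi (by linarith) a) (ae_of_all _ fun _ => (Real.exp_nonneg _)),
    integral_exp_mul_Ioi (by linarith)]
  congr 1
  field_simp

theorem reward_le (M : PhaseTypeRisk n) {b : Fin n → ℝ} (hb : ∀ i, 0 ≤ b i) (i : Fin n)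
    (u T : ℝ) : M.reward b i u T ≤ ENNReal.ofReal u + ENNReal.ofReal M.c * ENNReal.ofReal (1 / M.δ) := by
  rw [reward]
  gcongr
  · linarith [hb i]
  · refine (lintegral_mono_set (t := Set.Ici 0) fun s hs => hs.1.1).trans ?_
    rw [lintegral_exp_Ici M.δ_pos]
    simp

/-- After the first stay the surplus is at most `B` almost surely, so every later stay pays a
bounded amount, whatever the initial capital, and each stay passed costs a factor ρ. -/
theorem lintegral_term_succ_le (M : PhaseTypeRisk n) {b : Fin n → ℝ} (hb : ∀ i, 0 ≤ b i) {B : ℝ}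
    (hB : ∀ i, b i ≤ B) {ρ : ENNReal}
    (hρ : ∀ i, ∫⁻ ξ, ENNReal.ofReal (Real.exp (-M.δ * (ξ.1 i).1)) ∂M.noiseLaw ≤ ρ)
    (k : ℕ) (i : Fin n) (x : ℝ) : ∫⁻ ω, M.term b (k + 1) i x ω ∂M.law ≤
      ρ ^ (k + 1) * (ENNReal.ofReal B + ENNReal.ofReal M.c * ENNReal.ofReal (1 / M.δ)) := by
  have key : ∀ (k : ℕ) (C : ENNReal), (∀ i x, x ≤ B → ∫⁻ ω, M.term b k i x ω ∂M.law ≤ C) →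
      ∀ i x, ∫⁻ ω, M.term b (k + 1) i x ω ∂M.law ≤ ρ * C := by
    intro k C hC i x
    rw [lintegral_term_succ]
    calc _ ≤ ∫⁻ ξ, ENNReal.ofReal (Real.exp (-M.δ * (ξ.1 i).1)) * C ∂M.noiseLaw := by
          refine lintegral_mono_ae ?_
          filter_upwards [M.ae_noiseLaw_claim_pos] with ξ hξ
          split_ifs
          · gcongr
            exact hC _ _ (M.nextStay_surplus_le hB ξ _ hξ.le)
          · exact zero_le
      _ ≤ ρ * C := by
          rw [lintegral_mul_const _ (by fun_prop)]
          gcongr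
          exact hρ i
  induction k generalizing i x with
  | zero =>
    rw [zero_add, pow_one]
    refine key 0 _ (fun i x hx => ?_) i x
    rw [lintegral_term_zero]
    refine (lintegral_mono (g := fun _ => ENNReal.ofReal B + ENNReal.ofReal M.c *
      ENNReal.ofReal (1 / M.δ)) fun ξ => ?_).trans (by simp)
    dsimp only
    split_ifs
    · refine (M.reward_le hb _ _ _).trans ?_
      gcongr
    · exact zero_le
  | succ k ih =>
    rw [pow_succ', mul_assoc]
    exact key (k + 1) _ (fun i x _ => ih i x) i x

/-- Only the lump sum at time 0 depends on `x` without a bound; the other contributions are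
dominated by a geometric series. This bound is the integrability hypothesis of all later
computations. -/
theorem exists_expectedDividends_le (M : PhaseTypeRisk n) {b : Fin n → ℝ} (hb : ∀ i, 0 ≤ b i) :
    ∃ K : ENNReal, K ≠ ⊤ ∧ ∀ i x, M.expectedDividends b i x ≤ ENNReal.ofReal x + K := by
  obtain ⟨ρ, hρ1, hρ⟩ := M.exists_discount
  have hB : ∀ i, b i ≤ ∑ j, b j := fun i =>
    Finset.single_le_sum (fun j _ => hb j) (Finset.mem_univ i)
  set C := ENNReal.ofReal M.c * ENNReal.ofReal (1 / M.δ) with hC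
  have hCtop : C ≠ ⊤ := ENNReal.mul_ne_top ENNReal.ofReal_ne_top ENNReal.ofReal_ne_top
  refine ⟨C + (1 - ρ)⁻¹ * (ENNReal.ofReal (∑ j, b j) + C), ?_, fun i x => ?_⟩
  · refine ENNReal.add_ne_top.mpr ⟨hCtop, ENNReal.mul_ne_top ?_
      (ENNReal.add_ne_top.mpr ⟨ENNReal.ofReal_ne_top, hCtop⟩)⟩
    exact ENNReal.inv_ne_top.mpr (tsub_pos_of_lt hρ1).ne'
  · rw [expectedDividends_eq_tsum, tsum_eq_zero_add' ENNReal.summable, ← add_assoc]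
    refine add_le_add ?_ ?_
    · rw [lintegral_term_zero]
      refine (lintegral_mono (g := fun _ => ENNReal.ofReal x + C) fun ξ => ?_).trans (by simp)
      dsimp only
      split_ifs
      · exact M.reward_le hb _ _ _
      · exact zero_le
    · refine (ENNReal.tsum_le_tsum fun k => M.lintegral_term_succ_le hb hB hρ k i x).trans ?_
      rw [ENNReal.tsum_mul_right]
      gcongr
      rw [← ENNReal.tsum_geometric]
      exact ENNReal.tsum_le_tsum fun k => pow_le_pow_right_of_le_one' hρ1.le (Nat.le_succ k)

theorem expectedDividends_ne_top (M : PhaseTypeRisk n) {b : Fin n → ℝ} (hb : ∀ i, 0 ≤ b i)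
    (i : Fin n) (x : ℝ) : M.expectedDividends b i x ≠ ⊤ := by
  obtain ⟨K, hK, h⟩ := M.exists_expectedDividends_le hb
  exact ne_top_of_le_ne_top (ENNReal.add_ne_top.mpr ⟨ENNReal.ofReal_ne_top, hK⟩) (h i x)

theorem expectedDividends_of_neg (M : PhaseTypeRisk n) (b : Fin n → ℝ) (i : Fin n) {x : ℝ}
    (hx : x < 0) : M.expectedDividends b i x = 0 := by
  rw [← stepOp_expectedDividends, stepOp]
  simp [hx.not_ge]

theorem ofReal_sub_le_expectedDividends (M : PhaseTypeRisk n) (b : Fin n → ℝ) (i : Fin n) {x : ℝ}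
    (hx : 0 ≤ x) : ENNReal.ofReal (x - b i) ≤ M.expectedDividends b i x := by
  rw [← stepOp_expectedDividends, stepOp]
  refine le_trans (by simp) (lintegral_mono (f := fun _ => ENNReal.ofReal (x - b i)) fun ξ => ?_)
  simp only [hx, if_true, reward, add_assoc]
  exact le_self_add

/-! ### Policy improvement -/

/-- A policy-improvement principle: if following the barriers `b'` during one stay, and `b`
afterwards, is never worse than `b`, then `b'` is never worse than `b`. -/
theorem expectedDividends_le_of_le_stepOp (M : PhaseTypeRisk n) {b b' : Fin n → ℝ}
    (hb : ∀ i, 0 ≤ b i) (hb' : ∀ i, 0 ≤ b' i)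
    (h : ∀ i x, 0 ≤ x → M.expectedDividends b i x ≤ M.stepOp b' (M.expectedDividends b) i x)
    (i : Fin n) (x : ℝ) : M.expectedDividends b i x ≤ M.expectedDividends b' i x := by
  obtain ⟨ρ, hρ1, hρ⟩ := M.exists_discount
  obtain ⟨K, hK, hle⟩ := M.exists_expectedDividends_le hb
  set C := ENNReal.ofReal (∑ j, b' j) + K with hC
  have hCtop : C ≠ ⊤ := ENNReal.add_ne_top.mpr ⟨ENNReal.ofReal_ne_top, hK⟩
  -- Both values differ from `x` by bounded amounts, which starts the induction: the value of `b` is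
  -- at most `x + K`, and that of `b'` is at least `x - b' i`. Each application of the one-stay
  -- operator of `b'` then gains a factor ρ.
  have key : ∀ m : ℕ, ∀ i x, M.expectedDividends b i x ≤ M.expectedDividends b' i x + ρ ^ m * C := by
    intro m
    induction m with
    | zero =>
      intro i x
      rcases lt_or_ge x 0 with hx | hx
      · simp [M.expectedDividends_of_neg b i hx]
      · refine (hle i x).trans ?_
        rw [pow_zero, one_mul, hC, ← add_assoc]
        gcongr
        calc ENNReal.ofReal x ≤ ENNReal.ofReal (x - b' i + ∑ j, b' j) := by
              refine ENNReal.ofReal_le_ofReal ?_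
              linarith [Finset.single_le_sum (f := b') (fun j _ => hb' j) (Finset.mem_univ i)]
          _ ≤ _ := ENNReal.ofReal_add_le
          _ ≤ _ := by gcongr; exact M.ofReal_sub_le_expectedDividends b' i hx
    | succ m ih =>
      intro i x
      rcases lt_or_ge x 0 with hx | hx
      · simp [M.expectedDividends_of_neg b i hx]
      · refine (h i x hx).trans ((M.stepOp_mono b' ih i x).trans ?_)
        refine (M.stepOp_add_const_le b' hρ _ i x).trans ?_
        rw [stepOp_expectedDividends, pow_succ', mul_assoc]
  have hlim : Filter.Tendsto (fun m : ℕ => M.expectedDividends b' i x + ρ ^ m * C) Filter.atTop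
      (nhds (M.expectedDividends b' i x + 0 * C)) := by
    refine Filter.Tendsto.const_add _ ?_
    exact ENNReal.Tendsto.mul_const (ENNReal.tendsto_pow_atTop_nhds_zero_of_lt_one hρ1)
      (Or.inr hCtop)
  rw [zero_mul, add_zero] at hlim
  exact ge_of_tendsto' hlim fun m => key m i x

/-- No deviation from optimal barriers during one stay is an improvement everywhere. -/
theorem IsOptimalBarrier.not_lt_stepOp {M : PhaseTypeRisk n} {b b' : Fin n → ℝ}
    (hopt : M.IsOptimalBarrier b) (hb' : ∀ i, 0 ≤ b' i)
    (h : ∀ i x, 0 ≤ x → M.expectedDividends b i x ≤ M.stepOp b' (M.expectedDividends b) i x)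
    {i : Fin n} {x : ℝ} (hx : 0 ≤ x) (hxb : x < b i) :
    ¬ M.expectedDividends b i x < M.stepOp b' (M.expectedDividends b) i x := by
  rw [not_lt]
  -- It remains to bound one stay under `b'` followed by `b` by the value of `b'`; that value is a
  -- fixed point of the monotone operator and dominates the value of `b`.
  refine le_trans ?_ (hopt.2 b' hb' i x hx hxb)
  rw [← M.stepOp_expectedDividends b']
  exact M.stepOp_mono b' (M.expectedDividends_le_of_le_stepOp hopt.1 hb' h) i x

/-! ### Explicit form of the one-stay operator -/

/-- The expected value right after a claim that hits the surplus `u`. -/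
noncomputable def claimValue (M : PhaseTypeRisk n) (v : Fin n → ℝ → ENNReal) (u : ℝ) : ENNReal :=
  ∑ k, (∫⁻ y, v k (u - y) ∂expMeasure M.β) * M.init k

/-- The expected value right after a jump of the phase process out of phase `i`. -/
noncomputable def jumpValue (M : PhaseTypeRisk n) (v : Fin n → ℝ → ENNReal) (i : Fin n) (u : ℝ) :
    ENNReal :=
  ∑ j, Fin.lastCases (motive := fun _ => ENNReal) (M.claimValue v u) (fun j => v j u) j *
    M.jumpLaw i j

theorem measurable_claimValue (M : PhaseTypeRisk n) {v : Fin n → ℝ → ENNReal}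
    (hv : ∀ i, Measurable (v i)) : Measurable (M.claimValue v) := by
  have h2 : IsProbabilityMeasure (expMeasure M.β) := isProbabilityMeasure_expMeasure M.β_pos
  refine Finset.measurable_fun_sum _ fun k _ => Measurable.mul_const ?_ _
  exact Measurable.lintegral_prod_right' (f := fun p : ℝ × ℝ => v k (p.1 - p.2))
    ((hv k).comp (by fun_prop))

theorem measurable_jumpValue (M : PhaseTypeRisk n) {v : Fin n → ℝ → ENNReal}
    (hv : ∀ i, Measurable (v i)) (i : Fin n) : Measurable (M.jumpValue v i) := by
  refine Finset.measurable_fun_sum _ fun j _ => Measurable.mul_const ?_ _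
  induction j using Fin.lastCases with
  | last => simpa only [Fin.lastCases_last] using M.measurable_claimValue hv
  | cast j => simpa only [Fin.lastCases_castSucc] using hv j

theorem lintegral_jump (M : PhaseTypeRisk n) {v : Fin n → ℝ → ENNReal}
    (hv : ∀ i, Measurable (v i)) (i : Fin n) (u : ℝ) :
    ∫⁻ j, ∫⁻ q, Fin.lastCases (motive := fun _ => ENNReal) (v q.2 (u - q.1)) (fun j => v j u) j
      ∂((expMeasure M.β).prod M.init.toMeasure) ∂(M.jumpLaw i).toMeasure = M.jumpValue v i u := by
  have h2 : IsProbabilityMeasure (expMeasure M.β) := isProbabilityMeasure_expMeasure M.β_pos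
  rw [lintegral_fintype, jumpValue]
  refine Finset.sum_congr rfl fun j _ => ?_
  rw [PMF.toMeasure_apply_singleton _ _ (measurableSet_singleton j)]
  congr 1
  induction j using Fin.lastCases with
  | last =>
    simp only [Fin.lastCases_last]
    have hm : Measurable fun q : ℝ × Fin n => v q.2 (u - q.1) := by
      have h1 : Measurable (fun q : Fin n × ℝ => v q.1 q.2) :=
        measurable_from_prod_countable_right hv
      exact h1.comp (f := fun q : ℝ × Fin n => (q.2, u - q.1)) (by fun_prop)
    rw [lintegral_prod_symm _ hm.aemeasurable, lintegral_fintype, claimValue]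
    refine Finset.sum_congr rfl fun k _ => ?_
    rw [PMF.toMeasure_apply_singleton _ _ (measurableSet_singleton k)]
  | cast j => simp

theorem stepOp_eq_lintegral (M : PhaseTypeRisk n) (b : Fin n → ℝ) {v : Fin n → ℝ → ENNReal}
    (hv : ∀ i, Measurable (v i)) (i : Fin n) {x : ℝ} (hx : 0 ≤ x) :
    M.stepOp b v i x = ∫⁻ T, (M.reward b i x T + ENNReal.ofReal (Real.exp (-M.δ * T)) *
      M.jumpValue v i (min (x + M.c * T) (b i))) ∂expMeasure (M.exitRate i) := by
  have h1 : ∀ i, IsProbabilityMeasure (expMeasure (M.exitRate i)) :=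
    fun i => isProbabilityMeasure_expMeasure (M.exitRate_pos i)
  have h2 : IsProbabilityMeasure (expMeasure M.β) := isProbabilityMeasure_expMeasure M.β_pos
  have hpres : MeasurePreserving (Prod.map (fun z : Fin n → ℝ × Fin (n + 1) => z i)
      (id : ℝ × Fin n → ℝ × Fin n)) M.noiseLaw
      (((expMeasure (M.exitRate i)).prod (M.jumpLaw i).toMeasure).prod
        ((expMeasure M.β).prod M.init.toMeasure)) :=
    (measurePreserving_eval (fun i => (expMeasure (M.exitRate i)).prod
      (M.jumpLaw i).toMeasure) i).prod (MeasurePreserving.id _)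
  have hw : Measurable (fun q : (ℝ × Fin (n + 1)) × (ℝ × Fin n) =>
      Fin.lastCases (motive := fun _ => ENNReal) (v q.2.2 (min (x + M.c * q.1.1) (b i) - q.2.1))
        (fun j => v j (min (x + M.c * q.1.1) (b i))) q.1.2) := by
    have hv1 : Measurable (fun q : Fin n × ℝ => v q.1 q.2) :=
      measurable_from_prod_countable_right hv
    have h : Measurable (fun q : Fin (n + 1) × ((ℝ × Fin (n + 1)) × (ℝ × Fin n)) =>
        Fin.lastCases (motive := fun _ => ENNReal)
        (v q.2.2.2 (min (x + M.c * q.2.1.1) (b i) - q.2.2.1))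
        (fun j => v j (min (x + M.c * q.2.1.1) (b i))) q.1) := by
      refine measurable_from_prod_countable_right fun j => ?_
      induction j using Fin.lastCases with
      | last =>
        simp only [Fin.lastCases_last]
        exact hv1.comp (f := fun q : (ℝ × Fin (n + 1)) × (ℝ × Fin n) =>
          (q.2.2, min (x + M.c * q.1.1) (b i) - q.2.1)) (by fun_prop)
      | cast j =>
        simp only [Fin.lastCases_castSucc]
        exact (hv j).comp (f := fun q : (ℝ × Fin (n + 1)) × (ℝ × Fin n) =>
          min (x + M.c * q.1.1) (b i)) (by fun_prop)
    exact h.comp (f := fun q : (ℝ × Fin (n + 1)) × (ℝ × Fin n) => (q.1.2, q)) (by fun_prop)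
  have hr : Measurable (fun T => M.reward b i x T) :=
    (M.measurable_reward b i).comp measurable_prodMk_left
  have hg : Measurable (fun q : (ℝ × Fin (n + 1)) × (ℝ × Fin n) => M.reward b i x q.1.1 +
      ENNReal.ofReal (Real.exp (-M.δ * q.1.1)) * Fin.lastCases (motive := fun _ => ENNReal)
        (v q.2.2 (min (x + M.c * q.1.1) (b i) - q.2.1))
        (fun j => v j (min (x + M.c * q.1.1) (b i))) q.1.2) :=
    (hr.comp (by fun_prop)).add (Measurable.mul (by fun_prop) hw)
  have hstep : M.stepOp b v i x = ∫⁻ ξ, (fun q : (ℝ × Fin (n + 1)) × (ℝ × Fin n) =>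
      M.reward b i x q.1.1 +
      ENNReal.ofReal (Real.exp (-M.δ * q.1.1)) * Fin.lastCases (motive := fun _ => ENNReal)
        (v q.2.2 (min (x + M.c * q.1.1) (b i) - q.2.1))
        (fun j => v j (min (x + M.c * q.1.1) (b i))) q.1.2)
      (Prod.map (fun z : Fin n → ℝ × Fin (n + 1) => z i) (id : ℝ × Fin n → ℝ × Fin n) ξ)
      ∂M.noiseLaw := by
    refine lintegral_congr fun ξ => ?_
    simp only [hx, if_true, Prod.map_fst, Prod.map_snd, id, nextStay]
    congr 2
    induction (ξ.1 i).2 using Fin.lastCases <;> simp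
  rw [hstep, hpres.lintegral_comp hg, lintegral_prod _ hg.aemeasurable,
    lintegral_prod _ hg.lintegral_prod_right'.aemeasurable]
  refine lintegral_congr fun T => ?_
  simp only
  have hw1 : ∀ j, Measurable fun q : ℝ × Fin n => Fin.lastCases (motive := fun _ => ENNReal)
      (v q.2 (min (x + M.c * T) (b i) - q.1)) (fun j => v j (min (x + M.c * T) (b i))) j := fun j =>
    hw.comp (f := fun q : ℝ × Fin n => ((T, j), q)) measurable_prodMk_left
  rw [← M.lintegral_jump hv, ← lintegral_const_mul _ (measurable_of_finite _)]
  simp_rw [lintegral_add_left measurable_const, lintegral_const_mul _ (hw1 _)]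
  simp

theorem lintegral_expMeasure {r : ℝ} {f : ℝ → ENNReal} (hf : Measurable f) :
    ∫⁻ x, f x ∂expMeasure r =
      ∫⁻ x in Set.Ici 0, ENNReal.ofReal (r * Real.exp (-r * x)) * f x := by
  have hpdf : Measurable (gammaPDF 1 r) := (measurable_gammaPDFReal 1 r).ennreal_ofReal
  rw [expMeasure, gammaMeasure, lintegral_withDensity_eq_lintegral_mul _ hpdf hf, ← lintegral_indicator measurableSet_Ici]
  refine lintegral_congr fun x => ?_
  by_cases hx : 0 ≤ x
  · rw [Set.indicator_of_mem (Set.mem_Ici.mpr hx), Pi.mul_apply]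
    have h : gammaPDF 1 r x = ENNReal.ofReal (r * Real.exp (-(r * x))) :=
      exponentialPDF_of_nonneg hx
    rw [h, neg_mul]
  · rw [Set.indicator_of_notMem (s := Set.Ici 0) hx, Pi.mul_apply, gammaPDF_of_neg (not_le.mp hx), zero_mul]

theorem expMeasure_Ioi {r : ℝ} (hr : 0 < r) {a : ℝ} (ha : 0 ≤ a) :
    expMeasure r (Set.Ioi a) = ENNReal.ofReal (Real.exp (-r * a)) := by
  rw [← lintegral_indicator_one measurableSet_Ioi,
    lintegral_expMeasure (measurable_one.indicator measurableSet_Ioi)]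
  have : ∀ x : ℝ, ENNReal.ofReal (r * Real.exp (-r * x)) * (Set.Ioi a).indicator 1 x =
      (Set.Ioi a).indicator (fun x => ENNReal.ofReal (r * Real.exp (-r * x))) x := by
    intro x
    by_cases hx : x ∈ Set.Ioi a <;> simp [hx]
  simp_rw [this]
  have hsub : Set.Ioi a ⊆ Set.Ici 0 := fun x hx => ha.trans (le_of_lt hx)
  rw [setLIntegral_indicator measurableSet_Ioi, Set.inter_eq_left.mpr hsub, setLIntegral_congr Ioi_ae_eq_Ici]
  simp_rw [ENNReal.ofReal_mul hr.le]
  rw [lintegral_const_mul _ (by fun_prop), lintegral_exp_Ici hr, ← ENNReal.ofReal_mul hr.le]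
  congr 1
  field_simp

/-- By Tonelli: a payment at time `s` into the stay is made only if the stay lasts longer than `s`,
and this exponential tail merges with the discount into the single rate `M.exitRate i + M.δ`. -/
theorem lintegral_reward (M : PhaseTypeRisk n) (b : Fin n → ℝ) (i : Fin n) (x : ℝ) :
    ∫⁻ T, M.reward b i x T ∂expMeasure (M.exitRate i) = ENNReal.ofReal (x - b i) +
      ENNReal.ofReal M.c * ∫⁻ s in {s | 0 ≤ s ∧ b i ≤ x + M.c * s},
        ENNReal.ofReal (Real.exp (-(M.exitRate i + M.δ) * s)) := by
  have h1 : IsProbabilityMeasure (expMeasure (M.exitRate i)) :=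
    isProbabilityMeasure_expMeasure (M.exitRate_pos i)
  have hS : MeasurableSet {s | 0 ≤ s ∧ b i ≤ x + M.c * s} :=
    measurableSet_Ici.inter (measurableSet_le (f := fun _ => b i) measurable_const (by fun_prop))
  have hset : ∀ T, {s | s ∈ Set.Ico 0 T ∧ b i ≤ x + M.c * s} =
      Set.Iio T ∩ {s | 0 ≤ s ∧ b i ≤ x + M.c * s} := by
    intro T
    ext s
    simp only [Set.mem_ofPred_eq, Set.mem_Ico, Set.mem_inter_iff, Set.mem_Iio]
    tauto
  have hm : Measurable (fun p : ℝ × ℝ => {p : ℝ × ℝ | p.2 < p.1}.indicator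
      (fun p => ENNReal.ofReal (Real.exp (-M.δ * p.2))) p) :=
    Measurable.indicator (by fun_prop) (measurableSet_lt measurable_snd measurable_fst)
  have hin : ∀ T, ∫⁻ s in {s | s ∈ Set.Ico 0 T ∧ b i ≤ x + M.c * s},
      ENNReal.ofReal (Real.exp (-M.δ * s)) = ∫⁻ s in {s | 0 ≤ s ∧ b i ≤ x + M.c * s},
        {p : ℝ × ℝ | p.2 < p.1}.indicator
          (fun p => ENNReal.ofReal (Real.exp (-M.δ * p.2))) (T, s) := by
    intro T
    rw [hset, ← setLIntegral_indicator measurableSet_Iio]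
    rfl
  simp only [reward, hin]
  rw [lintegral_add_left measurable_const, lintegral_const_mul _ hm.lintegral_prod_right',
    lintegral_lintegral_swap hm.aemeasurable]
  simp only [lintegral_const, measure_univ, mul_one]
  congr 2
  refine setLIntegral_congr_fun hS fun s hs => ?_
  have : ∀ T : ℝ, {p : ℝ × ℝ | p.2 < p.1}.indicator
      (fun p => ENNReal.ofReal (Real.exp (-M.δ * p.2))) (T, s) =
      (Set.Ioi s).indicator (fun _ => ENNReal.ofReal (Real.exp (-M.δ * s))) T := by
    intro T
    by_cases hT : s < T <;> simp [hT]
  simp only [this]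
  rw [lintegral_indicator_const measurableSet_Ioi, expMeasure_Ioi (M.exitRate_pos i) hs.1,
    ← ENNReal.ofReal_mul (Real.exp_nonneg _), ← Real.exp_add]
  congr 2
  ring

theorem stepOp_eq_add (M : PhaseTypeRisk n) (b : Fin n → ℝ) {v : Fin n → ℝ → ENNReal}
    (hv : ∀ i, Measurable (v i)) (i : Fin n) {x : ℝ} (hx : 0 ≤ x) :
    M.stepOp b v i x = ENNReal.ofReal (x - b i) +
      ENNReal.ofReal M.c * (∫⁻ s in {s | 0 ≤ s ∧ b i ≤ x + M.c * s},
        ENNReal.ofReal (Real.exp (-(M.exitRate i + M.δ) * s))) +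
      ∫⁻ t in Set.Ici 0, ENNReal.ofReal (Real.exp (-(M.exitRate i + M.δ) * t)) *
        (ENNReal.ofReal (M.exitRate i) * M.jumpValue v i (min (x + M.c * t) (b i))) := by
  have hm : Measurable fun T => ENNReal.ofReal (Real.exp (-M.δ * T)) *
      M.jumpValue v i (min (x + M.c * T) (b i)) :=
    Measurable.mul (by fun_prop) ((M.measurable_jumpValue hv i).comp (by fun_prop))
  rw [stepOp_eq_lintegral M b hv i hx, lintegral_add_right _ hm, lintegral_reward,
    lintegral_expMeasure hm]
  congr 1
  refine lintegral_congr fun t => ?_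
  rw [← mul_assoc, ← mul_assoc, ENNReal.ofReal_mul (M.exitRate_pos i).le,
    mul_assoc (ENNReal.ofReal (M.exitRate i)), ← ENNReal.ofReal_mul (Real.exp_nonneg _),
    ← Real.exp_add, mul_comm (ENNReal.ofReal (M.exitRate i))]
  congr 4
  ring

theorem stepOp_of_barrier_le (M : PhaseTypeRisk n) (b : Fin n → ℝ) {v : Fin n → ℝ → ENNReal}
    (hv : ∀ i, Measurable (v i)) (i : Fin n) {x : ℝ} (hx : 0 ≤ x) (hbx : b i ≤ x) :
    M.stepOp b v i x = ENNReal.ofReal (x - b i) + ENNReal.ofReal (1 / (M.exitRate i + M.δ)) *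
      (ENNReal.ofReal M.c + ENNReal.ofReal (M.exitRate i) * M.jumpValue v i (b i)) := by
  have hq : 0 < M.exitRate i + M.δ := add_pos (M.exitRate_pos i) M.δ_pos
  have hset : {s | 0 ≤ s ∧ b i ≤ x + M.c * s} = Set.Ici 0 := by
    ext s
    simp only [Set.mem_ofPred_eq, Set.mem_Ici, and_iff_left_iff_imp]
    intro hs
    linarith [mul_nonneg M.c_pos.le hs]
  have hexp := lintegral_exp_Ici hq 0
  rw [mul_zero, Real.exp_zero] at hexp
  rw [stepOp_eq_add M b hv i hx, hset, hexp, add_assoc]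
  congr 1
  have : ∫⁻ t in Set.Ici 0, ENNReal.ofReal (Real.exp (-(M.exitRate i + M.δ) * t)) *
        (ENNReal.ofReal (M.exitRate i) * M.jumpValue v i (min (x + M.c * t) (b i))) =
      ∫⁻ t in Set.Ici 0, ENNReal.ofReal (Real.exp (-(M.exitRate i + M.δ) * t)) *
        (ENNReal.ofReal (M.exitRate i) * M.jumpValue v i (b i)) := by
    refine setLIntegral_congr_fun measurableSet_Ici fun t ht => ?_
    rw [min_eq_right]
    linarith [mul_nonneg M.c_pos.le (Set.mem_Ici.mp ht)]
  rw [this, lintegral_mul_const _ (by fun_prop), hexp]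
  ring

theorem stepOp_of_le_barrier (M : PhaseTypeRisk n) (b : Fin n → ℝ) {v : Fin n → ℝ → ENNReal}
    (hv : ∀ i, Measurable (v i)) (i : Fin n) {x : ℝ} (hx : 0 ≤ x) (hbx : x ≤ b i) :
    M.stepOp b v i x = (∫⁻ t in Set.Ico 0 ((b i - x) / M.c),
        ENNReal.ofReal (Real.exp (-(M.exitRate i + M.δ) * t)) *
        (ENNReal.ofReal (M.exitRate i) * M.jumpValue v i (x + M.c * t))) +
      ENNReal.ofReal (Real.exp (-(M.exitRate i + M.δ) * ((b i - x) / M.c)) /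
        (M.exitRate i + M.δ)) *
      (ENNReal.ofReal M.c + ENNReal.ofReal (M.exitRate i) * M.jumpValue v i (b i)) := by
  have hq : 0 < M.exitRate i + M.δ := add_pos (M.exitRate_pos i) M.δ_pos
  have hc := M.c_pos
  have hs0 : 0 ≤ (b i - x) / M.c := div_nonneg (by linarith) hc.le
  have hset : {s | 0 ≤ s ∧ b i ≤ x + M.c * s} = Set.Ici ((b i - x) / M.c) := by
    ext s
    simp only [Set.mem_ofPred_eq, Set.mem_Ici, div_le_iff₀ hc]
    constructor
    · rintro ⟨_, h⟩; linarith
    · intro h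
      refine ⟨hs0.trans ((div_le_iff₀ hc).mpr h), by linarith⟩
  rw [stepOp_eq_add M b hv i hx, hset, lintegral_exp_Ici hq,
    ENNReal.ofReal_of_nonpos (by linarith : x - b i ≤ 0), zero_add]
  have hunion : Set.Ici (0:ℝ) = Set.Ico 0 ((b i - x) / M.c) ∪ Set.Ici ((b i - x) / M.c) :=
    (Set.Ico_union_Ici_eq_Ici hs0).symm
  rw [hunion, lintegral_union measurableSet_Ici
    (Set.disjoint_left.mpr fun t h1 h2 => (not_le.mpr h1.2) h2)]
  have e1 : ∫⁻ t in Set.Ico 0 ((b i - x) / M.c),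
      ENNReal.ofReal (Real.exp (-(M.exitRate i + M.δ) * t)) *
        (ENNReal.ofReal (M.exitRate i) * M.jumpValue v i (min (x + M.c * t) (b i))) =
      ∫⁻ t in Set.Ico 0 ((b i - x) / M.c),
      ENNReal.ofReal (Real.exp (-(M.exitRate i + M.δ) * t)) *
        (ENNReal.ofReal (M.exitRate i) * M.jumpValue v i (x + M.c * t)) := by
    refine setLIntegral_congr_fun measurableSet_Ico fun t ht => ?_
    rw [min_eq_left]
    have := (lt_div_iff₀ hc).mp ht.2
    linarith
  have e2 : ∫⁻ t in Set.Ici ((b i - x) / M.c),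
      ENNReal.ofReal (Real.exp (-(M.exitRate i + M.δ) * t)) *
        (ENNReal.ofReal (M.exitRate i) * M.jumpValue v i (min (x + M.c * t) (b i))) =
      ∫⁻ t in Set.Ici ((b i - x) / M.c),
      ENNReal.ofReal (Real.exp (-(M.exitRate i + M.δ) * t)) *
        (ENNReal.ofReal (M.exitRate i) * M.jumpValue v i (b i)) := by
    refine setLIntegral_congr_fun measurableSet_Ici fun t ht => ?_
    rw [min_eq_right]
    have := (div_le_iff₀ hc).mp ht
    linarith
  rw [e1, e2, lintegral_mul_const _ (by fun_prop), lintegral_exp_Ici hq]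
  ring

theorem claimValue_le (M : PhaseTypeRisk n) {v : Fin n → ℝ → ENNReal} {K : ENNReal}
    (hle : ∀ i x, v i x ≤ ENNReal.ofReal x + K) (u : ℝ) :
    M.claimValue v u ≤ ENNReal.ofReal u + K := by
  have h2 : IsProbabilityMeasure (expMeasure M.β) := isProbabilityMeasure_expMeasure M.β_pos
  have hk : ∀ k, ∫⁻ y, v k (u - y) ∂expMeasure M.β ≤ ENNReal.ofReal u + K := fun k => by
    refine (lintegral_mono_ae (g := fun _ => ENNReal.ofReal u + K) ?_).trans (by simp)
    filter_upwards [ae_expMeasure_pos] with y hy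
    refine (hle _ _).trans ?_
    gcongr
    linarith
  refine (Finset.sum_le_sum fun k _ => mul_le_mul_left (hk k) (M.init k)).trans ?_
  rw [← Finset.mul_sum, (tsum_fintype (fun k => M.init k)).symm.trans M.init.tsum_coe, mul_one]

theorem jumpValue_le (M : PhaseTypeRisk n) {v : Fin n → ℝ → ENNReal} {K : ENNReal}
    (hle : ∀ i x, v i x ≤ ENNReal.ofReal x + K) (i : Fin n) (u : ℝ) :
    M.jumpValue v i u ≤ ENNReal.ofReal u + K := by
  refine (Finset.sum_le_sum fun j _ => mul_le_mul_left
    (b := Fin.lastCases (motive := fun _ => ENNReal) (M.claimValue v u) (fun j => v j u) j)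
    (c := ENNReal.ofReal u + K) ?_ (M.jumpLaw i j)).trans ?_
  · induction j using Fin.lastCases with
    | last => simpa using M.claimValue_le hle u
    | cast j => simpa using hle j u
  · rw [← Finset.mul_sum,
      (tsum_fintype (fun j => M.jumpLaw i j)).symm.trans (M.jumpLaw i).tsum_coe, mul_one]

/-! ### Passage to real-valued formulas under linear growth -/

/-- The intensity with which the jumps of the phase process out of phase `i` yield value. -/
noncomputable def jumpRate (M : PhaseTypeRisk n) (v : Fin n → ℝ → ENNReal) (i : Fin n) (u : ℝ) :
    ℝ := M.exitRate i * (M.jumpValue v i u).toReal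

theorem jumpRate_nonneg (M : PhaseTypeRisk n) (v : Fin n → ℝ → ENNReal) (i : Fin n) (u : ℝ) :
    0 ≤ M.jumpRate v i u :=
  mul_nonneg (M.exitRate_pos i).le ENNReal.toReal_nonneg

theorem measurable_jumpRate (M : PhaseTypeRisk n) {v : Fin n → ℝ → ENNReal}
    (hv : ∀ i, Measurable (v i)) (i : Fin n) : Measurable (M.jumpRate v i) :=
  (M.measurable_jumpValue hv i).ennreal_toReal.const_mul _

section LinearGrowth

variable {v : Fin n → ℝ → ENNReal} {K : ENNReal}

theorem jumpValue_ne_top (M : PhaseTypeRisk n) (hK : K ≠ ⊤)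
    (hle : ∀ i x, v i x ≤ ENNReal.ofReal x + K) (i : Fin n) (u : ℝ) : M.jumpValue v i u ≠ ⊤ :=
  ne_top_of_le_ne_top (ENNReal.add_ne_top.mpr ⟨ENNReal.ofReal_ne_top, hK⟩) (M.jumpValue_le hle i u)

theorem ofReal_jumpRate (M : PhaseTypeRisk n) (hK : K ≠ ⊤)
    (hle : ∀ i x, v i x ≤ ENNReal.ofReal x + K) (i : Fin n) (u : ℝ) :
    ENNReal.ofReal (M.exitRate i) * M.jumpValue v i u = ENNReal.ofReal (M.jumpRate v i u) := by
  rw [jumpRate, ENNReal.ofReal_mul (M.exitRate_pos i).le,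
    ENNReal.ofReal_toReal (M.jumpValue_ne_top hK hle i u)]

theorem jumpRate_le (M : PhaseTypeRisk n) (hK : K ≠ ⊤)
    (hle : ∀ i x, v i x ≤ ENNReal.ofReal x + K) (i : Fin n) {u B : ℝ} (hB : 0 ≤ B) (hu : u ≤ B) :
    M.jumpRate v i u ≤ M.exitRate i * (B + K.toReal) := by
  refine mul_le_mul_of_nonneg_left ?_ (M.exitRate_pos i).le
  refine ENNReal.toReal_le_of_le_ofReal (by positivity) ((M.jumpValue_le hle i u).trans ?_)
  rw [ENNReal.ofReal_add hB ENNReal.toReal_nonneg, ENNReal.ofReal_toReal hK]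
  gcongr

theorem stepOp_of_barrier_le_eq_ofReal (M : PhaseTypeRisk n) (b : Fin n → ℝ)
    (hv : ∀ i, Measurable (v i)) (hK : K ≠ ⊤) (hle : ∀ i x, v i x ≤ ENNReal.ofReal x + K)
    (i : Fin n) {x : ℝ} (hx : 0 ≤ x) (hbx : b i ≤ x) :
    M.stepOp b v i x = ENNReal.ofReal
      (x - b i + (M.c + M.jumpRate v i (b i)) / (M.exitRate i + M.δ)) := by
  have hq : 0 < M.exitRate i + M.δ := add_pos (M.exitRate_pos i) M.δ_pos
  have hh := M.jumpRate_nonneg v i (b i)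
  have hc := M.c_pos
  rw [M.stepOp_of_barrier_le b hv i hx hbx, M.ofReal_jumpRate hK hle,
    ← ENNReal.ofReal_add hc.le hh, ← ENNReal.ofReal_mul (by positivity),
    ← ENNReal.ofReal_add (by linarith) (by positivity), one_div_mul_eq_div]

theorem toReal_stepOp_of_barrier_le (M : PhaseTypeRisk n) (b : Fin n → ℝ)
    (hv : ∀ i, Measurable (v i)) (hK : K ≠ ⊤) (hle : ∀ i x, v i x ≤ ENNReal.ofReal x + K)
    (i : Fin n) {x : ℝ} (hx : 0 ≤ x) (hbx : b i ≤ x) :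
    (M.stepOp b v i x).toReal =
      x - b i + (M.c + M.jumpRate v i (b i)) / (M.exitRate i + M.δ) := by
  have hq : 0 < M.exitRate i + M.δ := add_pos (M.exitRate_pos i) M.δ_pos
  have hh := M.jumpRate_nonneg v i (b i)
  have hc := M.c_pos
  rw [M.stepOp_of_barrier_le_eq_ofReal b hv hK hle i hx hbx, ENNReal.toReal_ofReal]
  have : 0 ≤ x - b i := by linarith
  positivity

theorem intervalIntegrable_jumpRate (M : PhaseTypeRisk n) (hv : ∀ i, Measurable (v i))
    (hK : K ≠ ⊤) (hle : ∀ i x, v i x ≤ ENNReal.ofReal x + K) (i : Fin n) (a d : ℝ) :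
    IntervalIntegrable (M.jumpRate v i) volume a d := by
  have hc : IntervalIntegrable (fun s : ℝ => M.exitRate i * (|s| + K.toReal)) volume a d :=
    Continuous.intervalIntegrable (by fun_prop) _ _
  refine hc.mono_fun' (M.measurable_jumpRate hv i).aestronglyMeasurable (ae_of_all _ fun s => ?_)
  dsimp only
  rw [Real.norm_of_nonneg (M.jumpRate_nonneg v i s)]
  exact M.jumpRate_le hK hle i (abs_nonneg s) (le_abs_self s)

theorem intervalIntegrable_toReal (hv : ∀ i, Measurable (v i)) (hK : K ≠ ⊤)
    (hle : ∀ i x, v i x ≤ ENNReal.ofReal x + K) (i : Fin n) (a d : ℝ) :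
    IntervalIntegrable (fun s => (v i s).toReal) volume a d := by
  have hc : IntervalIntegrable (fun s : ℝ => |s| + K.toReal) volume a d :=
    Continuous.intervalIntegrable (by fun_prop) _ _
  refine hc.mono_fun' (hv i).ennreal_toReal.aestronglyMeasurable (ae_of_all _ fun s => ?_)
  dsimp only
  rw [Real.norm_of_nonneg ENNReal.toReal_nonneg]
  refine ENNReal.toReal_le_of_le_ofReal (by positivity) ((hle i s).trans ?_)
  rw [ENNReal.ofReal_add (abs_nonneg s) ENNReal.toReal_nonneg, ENNReal.ofReal_toReal hK]
  gcongr
  exact le_abs_self s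

/-- The substitution `s = x + c t` replaces time by surplus. Afterwards `x` occurs only in the
exponential prefactor and as the lower limit of integration, the form suited to differentiation and
to splitting at an intermediate surplus. -/
theorem toReal_stepOp_of_le_barrier (M : PhaseTypeRisk n) (b : Fin n → ℝ)
    (hv : ∀ i, Measurable (v i)) (hK : K ≠ ⊤) (hle : ∀ i x, v i x ≤ ENNReal.ofReal x + K)
    (i : Fin n) {x : ℝ} (hx : 0 ≤ x) (hbx : x ≤ b i) :
    (M.stepOp b v i x).toReal = Real.exp ((M.exitRate i + M.δ) / M.c * x) *
      ((∫ s in x..b i, Real.exp (-((M.exitRate i + M.δ) / M.c) * s) * M.jumpRate v i s) / M.c +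
        Real.exp (-((M.exitRate i + M.δ) / M.c) * b i) *
        ((M.c + M.jumpRate v i (b i)) / (M.exitRate i + M.δ))) := by
  have hq : 0 < M.exitRate i + M.δ := add_pos (M.exitRate_pos i) M.δ_pos
  have hh := M.jumpRate_nonneg v i
  have hc := M.c_pos
  have hs0 : 0 ≤ (b i - x) / M.c := div_nonneg (by linarith) hc.le
  set q := M.exitRate i + M.δ with hqdef
  have hmeas : Measurable fun t => Real.exp (-q * t) * M.jumpRate v i (x + M.c * t) :=
    Measurable.mul (by fun_prop) ((M.measurable_jumpRate hv i).comp (by fun_prop))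
  have hfin : ∫⁻ t in Set.Ico 0 ((b i - x) / M.c),
      ENNReal.ofReal (Real.exp (-q * t) * M.jumpRate v i (x + M.c * t)) ≠ ⊤ := by
    refine ne_top_of_le_ne_top (b := ∫⁻ t in Set.Ico 0 ((b i - x) / M.c),
      ENNReal.ofReal (M.exitRate i * (b i + K.toReal))) ?_ ?_
    · rw [setLIntegral_const]
      exact ENNReal.mul_ne_top ENNReal.ofReal_ne_top (by simp)
    · refine setLIntegral_mono measurable_const fun t ht => ENNReal.ofReal_le_ofReal ?_
      have h1 : Real.exp (-q * t) ≤ 1 := Real.exp_le_one_iff.mpr (by nlinarith [ht.1])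
      have h2 := (lt_div_iff₀ hc).mp ht.2
      exact (mul_le_of_le_one_left (hh _) h1).trans
        (M.jumpRate_le hK hle i (hx.trans hbx) (by linarith))
  rw [M.stepOp_of_le_barrier b hv i hx hbx, ← hqdef]
  simp_rw [M.ofReal_jumpRate hK hle]
  rw [← ENNReal.ofReal_add hc.le (hh _)]
  simp_rw [← ENNReal.ofReal_mul (Real.exp_nonneg _)]
  rw [← ENNReal.ofReal_mul (by positivity), ENNReal.toReal_add hfin ENNReal.ofReal_ne_top,
    ENNReal.toReal_ofReal (mul_nonneg (by positivity) (by linarith [hh (b i)])),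
    ← integral_eq_lintegral_of_nonneg_ae (ae_of_all _ fun t => mul_nonneg (Real.exp_nonneg _) (hh _))
      hmeas.aestronglyMeasurable,
    integral_Ico_eq_integral_Ioc, ← intervalIntegral.integral_of_le hs0]
  have hsub := intervalIntegral.mul_integral_comp_add_mul (a := 0) (b := (b i - x) / M.c)
    (f := fun s => Real.exp (-(q / M.c) * s) * M.jumpRate v i s) M.c x
  have hend : x + M.c * ((b i - x) / M.c) = b i := by field_simp; ring
  rw [mul_zero, add_zero, hend] at hsub
  rw [← hsub, mul_div_cancel_left₀ _ hc.ne', mul_add (Real.exp (q / M.c * x)), ← intervalIntegral.integral_const_mul]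
  congr 1
  · refine intervalIntegral.integral_congr fun t _ => ?_
    rw [← mul_assoc, ← Real.exp_add]
    congr 2
    field_simp
    ring
  · rw [← mul_assoc, ← Real.exp_add, div_mul_eq_mul_div, mul_div_assoc]
    congr 2
    field_simp
    ring

/-- Claims larger than `u` ruin the company and contribute nothing. For the others, `s = u - y` and
the factor `exp (β u)` make the integrand independent of `u`; this is where exponential claims give
a first-order equation. -/
theorem exp_mul_toReal_claimValue (M : PhaseTypeRisk n)
    (hv : ∀ i, Measurable (v i)) (hK : K ≠ ⊤) (hle : ∀ i x, v i x ≤ ENNReal.ofReal x + K)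
    (hneg : ∀ i x, x < 0 → v i x = 0) {u : ℝ} (hu : 0 ≤ u) :
    Real.exp (M.β * u) * (M.claimValue v u).toReal =
      ∑ k, (M.init k).toReal * ∫ s in 0..u, M.β * Real.exp (M.β * s) * (v k s).toReal := by
  have h2 : IsProbabilityMeasure (expMeasure M.β) := isProbabilityMeasure_expMeasure M.β_pos
  have hβ := M.β_pos
  have htop : ∀ k s, v k s ≠ ⊤ := fun k s =>
    ne_top_of_le_ne_top (ENNReal.add_ne_top.mpr ⟨ENNReal.ofReal_ne_top, hK⟩) (hle k s)
  have hk : ∀ k, (∫⁻ y, v k (u - y) ∂expMeasure M.β).toReal =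
      ∫ y in 0..u, M.β * Real.exp (-M.β * y) * (v k (u - y)).toReal := by
    intro k
    have hm : Measurable fun y => v k (u - y) := (hv k).comp (by fun_prop)
    rw [lintegral_expMeasure hm, intervalIntegral.integral_of_le hu,
      ← integral_Icc_eq_integral_Ioc]
    have hind : ∀ y, (Set.Ici 0).indicator
        (fun y => ENNReal.ofReal (M.β * Real.exp (-M.β * y)) * v k (u - y)) y =
        (Set.Icc 0 u).indicator
        (fun y => ENNReal.ofReal (M.β * Real.exp (-M.β * y)) * v k (u - y)) y := by
      intro y
      rcases lt_or_ge u y with h | h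
      · rw [Set.indicator_of_notMem (s := Set.Icc 0 u) (fun h' => absurd h'.2 (not_le.mpr h))]
        refine Set.indicator_apply_eq_zero.mpr fun _ => ?_
        rw [hneg k _ (by linarith), mul_zero]
      · by_cases h0 : 0 ≤ y
        · rw [Set.indicator_of_mem (Set.mem_Ici.mpr h0), Set.indicator_of_mem (s := Set.Icc 0 u) ⟨h0, h⟩]
        · rw [Set.indicator_of_notMem (s := Set.Ici 0) h0,
            Set.indicator_of_notMem (s := Set.Icc 0 u) (fun h' => h0 h'.1)]
    rw [← lintegral_indicator measurableSet_Ici, lintegral_congr hind,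
      lintegral_indicator measurableSet_Icc, ← integral_toReal
        (Measurable.fun_mul (f := fun y => ENNReal.ofReal (M.β * Real.exp (-M.β * y)))
          (by fun_prop) hm).aemeasurable
        (ae_of_all _ fun y => ENNReal.mul_lt_top ENNReal.ofReal_lt_top (htop _ _).lt_top)]
    refine integral_congr_ae (ae_of_all _ fun y => ?_)
    dsimp only
    rw [ENNReal.toReal_mul, ENNReal.toReal_ofReal (by positivity)]
  have hfin : ∀ k, ∫⁻ y, v k (u - y) ∂expMeasure M.β ≠ ⊤ := fun k => by
    refine ne_top_of_le_ne_top (b := ENNReal.ofReal u + K)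
      (ENNReal.add_ne_top.mpr ⟨ENNReal.ofReal_ne_top, hK⟩) ?_
    refine (lintegral_mono_ae (g := fun _ => ENNReal.ofReal u + K) ?_).trans (by simp)
    filter_upwards [ae_expMeasure_pos] with y hy
    refine (hle _ _).trans ?_
    gcongr
    linarith
  rw [claimValue, ENNReal.toReal_sum fun k _ => ENNReal.mul_ne_top (hfin k) (M.init.apply_ne_top k),
    Finset.mul_sum]
  refine Finset.sum_congr rfl fun k _ => ?_
  rw [ENNReal.toReal_mul, hk, mul_comm _ (M.init k).toReal, mul_left_comm]
  congr 1
  have hsub := intervalIntegral.integral_comp_sub_left (a := 0) (b := u)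
    (fun s => M.β * Real.exp (M.β * s) * (v k s).toReal) u
  rw [sub_self, sub_zero] at hsub
  rw [← hsub, ← intervalIntegral.integral_const_mul]
  refine intervalIntegral.integral_congr fun t _ => ?_
  rw [mul_sub, sub_eq_add_neg (M.β * u), Real.exp_add, neg_mul]
  ring

end LinearGrowth

theorem exitRate_mul_jumpLaw (M : PhaseTypeRisk n) (i : Fin n) (j : Fin (n + 1)) :
    M.exitRate i * (M.jumpLaw i j).toReal = if j = i.castSucc then 0 else M.rate i j := by
  rw [jumpLaw, PMF.ofFintype_apply]
  split_ifs with h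
  · simp
  · rw [ENNReal.toReal_ofReal (div_nonneg (M.rate_nonneg i j h) (M.exitRate_pos i).le),
      mul_div_cancel₀ _ (M.exitRate_pos i).ne']

theorem jumpRate_eq_sum (M : PhaseTypeRisk n) {v : Fin n → ℝ → ENNReal} {K : ENNReal} (hK : K ≠ ⊤)
    (hle : ∀ i x, v i x ≤ ENNReal.ofReal x + K) (i : Fin n) (u : ℝ) :
    M.jumpRate v i u = (∑ j : Fin n, (if j = i then 0 else M.rate i j.castSucc) * (v j u).toReal) +
      M.rate i (Fin.last n) * (M.claimValue v u).toReal := by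
  have htop : ∀ k, v k u ≠ ⊤ := fun k =>
    ne_top_of_le_ne_top (ENNReal.add_ne_top.mpr ⟨ENNReal.ofReal_ne_top, hK⟩) (hle k u)
  have htop2 : M.claimValue v u ≠ ⊤ :=
    ne_top_of_le_ne_top (ENNReal.add_ne_top.mpr ⟨ENNReal.ofReal_ne_top, hK⟩) (M.claimValue_le hle u)
  rw [jumpRate, jumpValue, ENNReal.toReal_sum, Fin.sum_univ_castSucc, mul_add, Finset.mul_sum]
  · simp only [Fin.lastCases_castSucc, Fin.lastCases_last, ENNReal.toReal_mul]
    congr 1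
    · refine Finset.sum_congr rfl fun j _ => ?_
      rw [mul_left_comm, M.exitRate_mul_jumpLaw, mul_comm]
      simp only [Fin.castSucc_inj]
    · rw [mul_left_comm, M.exitRate_mul_jumpLaw, mul_comm, if_neg (Fin.castSucc_lt_last i).ne']
  · intro j _
    refine ENNReal.mul_ne_top ?_ ((M.jumpLaw i).apply_ne_top j)
    induction j using Fin.lastCases with
    | last => simpa using htop2
    | cast j => simpa using htop j

end PhaseTypeRisk

/-! ### The analytic core: a sign argument for a linear system -/

/-- Let `(φ, γ)` solve a linear system on `[a, d]` with `φ d = 1`. If `φ` does not stay at or below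
`1` on any `[y, d]` with `φ y < 1`, and its derivative at `d` is nonnegative, then `φ` is
decreasing. -/
theorem antitoneOn_of_linear_system {a d c β q l k p₁ p₂ : ℝ} (hc : 0 < c) (hβ : 0 < β)
    (had : a < d) (hkq : k * p₂ ≤ q) {φ γ : ℝ → ℝ}
    (hφc : ContinuousOn φ (Set.Icc a d)) (hγc : ContinuousOn γ (Set.Icc a d))
    (hφ : ∀ x ∈ Set.Ioo a d, HasDerivAt φ ((q * φ x - l - k * γ x) / c) x)
    (hγ : ∀ x ∈ Set.Ioo a d, HasDerivAt γ (β * (p₁ + p₂ * φ x - γ x)) x)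
    (hφd : φ d = 1)
    (h₁ : ∀ y ∈ Set.Ioo a d, (∀ x ∈ Set.Icc y d, φ x ≤ 1) → 1 ≤ φ y)
    (h₂ : 0 ≤ q - l - k * γ d) : AntitoneOn φ (Set.Icc a d) := by
  set g : ℝ → ℝ := fun x => (q * φ x - l - k * γ x) / c with hgdef
  set η : ℝ → ℝ := fun x => β * (p₁ + p₂ * φ x - γ x) with hηdef
  set g₁ : ℝ → ℝ := fun x => (q * g x - k * η x) / c with hg₁def
  have hgc : ContinuousOn g (Set.Icc a d) := by fun_prop
  have hηc : ContinuousOn η (Set.Icc a d) := by fun_prop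
  have hg₁c : ContinuousOn g₁ (Set.Icc a d) := by fun_prop
  have hg : ∀ x ∈ Set.Ioo a d, HasDerivAt g (g₁ x) x := fun x hx =>
    ((((hφ x hx).const_mul q).sub_const l).sub ((hγ x hx).const_mul k)).div_const c
  have hη : ∀ x ∈ Set.Ioo a d, HasDerivAt η (β * (p₂ * g x - η x)) x := fun x hx =>
    ((((hφ x hx).const_mul p₂).const_add p₁).sub (hγ x hx)).const_mul β
  have hg₁ : ∀ x ∈ Set.Ioo a d, HasDerivAt g₁ ((q * g₁ x - k * (β * (p₂ * g x - η x))) / c) x :=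
    fun x hx => (((hg x hx).const_mul q).sub ((hη x hx).const_mul k)).div_const c
  -- wherever `g` is nonnegative up to `d`, it vanishes
  have hpos : ∀ y ∈ Set.Ioo a d, 0 < g y → ¬ ∀ x ∈ Set.Icc y d, 0 ≤ g x := by
    intro y hy hgy hnn
    have hsub : Set.Icc y d ⊆ Set.Icc a d := Set.Icc_subset_Icc_left hy.1.le
    have hmono : MonotoneOn φ (Set.Icc y d) := by
      refine monotoneOn_of_deriv_nonneg (convex_Icc _ _) (hφc.mono hsub) ?_ ?_
      all_goals
        rw [interior_Icc]
        intro x hx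
      · exact (hφ x ⟨hy.1.trans hx.1, hx.2⟩).differentiableAt.differentiableWithinAt
      · rw [(hφ x ⟨hy.1.trans hx.1, hx.2⟩).deriv]
        exact hnn x ⟨hx.1.le, hx.2.le⟩
    have hle : ∀ x ∈ Set.Icc y d, φ x ≤ 1 := fun x hx =>
      hφd ▸ hmono hx (Set.right_mem_Icc.mpr hy.2.le) hx.2
    have h1 := h₁ y hy hle
    have hconst : ∀ x ∈ Set.Icc y d, φ x = 1 := fun x hx => le_antisymm (hle x hx)
      (h1.trans (hmono (Set.left_mem_Icc.mpr hy.2.le) hx hx.1))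
    have hderiv : HasDerivWithinAt φ 0 (Set.Ici y) y := by
      refine ((hasDerivWithinAt_const y (Set.Ici y) (1 : ℝ)).congr_of_eventuallyEq ?_
        (hconst y (Set.left_mem_Icc.mpr hy.2.le)))
      filter_upwards [Icc_mem_nhdsGE hy.2] with x hx using hconst x hx
    exact hgy.ne' ((uniqueDiffOn_Ici y y Set.self_mem_Ici).eq_deriv _
      (hφ y hy).hasDerivWithinAt hderiv)
  -- Here `h₂` gives one inequality; a positive value would persist on an interval ending at `d`,
  -- against `hpos`.
  have hgd : g d = 0 := by
    refine le_antisymm ?_ (div_nonneg (by rw [hφd, mul_one]; exact h₂) hc.le)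
    by_contra! hgd
    have hev : ∀ᶠ x in nhdsWithin d (Set.Iic d), 0 < g x := by
      have := (hgc d (Set.right_mem_Icc.mpr had.le)).mono_of_mem_nhdsWithin
        (Icc_mem_nhdsLE had)
      exact this.eventually (lt_mem_nhds hgd)
    obtain ⟨y, hy, hyd⟩ := mem_nhdsLE_iff_exists_Icc_subset.mp hev
    -- The midpoint keeps `z` strictly inside the interval, since `y` may lie below `a`.
    set z := max y ((a + d) / 2) with hz
    have hzd : z < d := max_lt hy (by linarith)
    have hza : a < z := lt_max_of_lt_right (by linarith)
    exact hpos z ⟨hza, hzd⟩ (hyd ⟨le_max_left _ _, hzd.le⟩)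
      fun x hx => le_of_lt (hyd ⟨(le_max_left _ _).trans hx.1, hx.2⟩)
  -- Eliminating `η` gives `c g'' = (q - cβ) g' + β (q - k p₂) g`. The exponential removes the
  -- damping term, so up to a positive factor the derivative of `E` is `g'² + (β (q - k p₂) / c)
  -- g²`, nonnegative by `hkq`.
  set E : ℝ → ℝ := fun x => Real.exp (-((q - c * β) / c) * x) * (g x * g₁ x) with hEdef
  have hEmono : MonotoneOn E (Set.Icc a d) := by
    have hE : ∀ x ∈ Set.Ioo a d, HasDerivAt E (Real.exp (-((q - c * β) / c) * x) *
        (g₁ x ^ 2 + β * (q - k * p₂) / c * g x ^ 2)) x := by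
      intro x hx
      have he : HasDerivAt (fun x : ℝ => Real.exp (-((q - c * β) / c) * x))
          (Real.exp (-((q - c * β) / c) * x) * (-((q - c * β) / c) * 1)) x :=
        ((hasDerivAt_id x).const_mul _).exp
      refine (he.mul ((hg x hx).mul (hg₁ x hx))).congr_deriv ?_
      have hkη : k * η x = q * g x - c * g₁ x := by
        simp only [hg₁def]
        field_simp
        ring
      have : (q * g₁ x - k * (β * (p₂ * g x - η x))) / c =
          ((q - c * β) * g₁ x + β * (q - k * p₂) * g x) / c := by
        congr 1
        linear_combination β * hkη
      rw [this, Pi.mul_apply]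
      field_simp
      ring
    refine monotoneOn_of_deriv_nonneg (convex_Icc _ _) (by fun_prop) ?_ ?_
    all_goals
      rw [interior_Icc]
      intro x hx
    · exact (hE x hx).differentiableAt.differentiableWithinAt
    · rw [(hE x hx).deriv]
      have : 0 ≤ q - k * p₂ := by linarith
      positivity
  have hgg₁ : ∀ x ∈ Set.Icc a d, g x * g₁ x ≤ 0 := by
    intro x hx
    have h := hEmono hx (Set.right_mem_Icc.mpr had.le) hx.2
    have h0 : E d = 0 := by simp [hEdef, hgd]
    rw [h0] at h
    exact nonpos_of_mul_nonpos_right h (Real.exp_pos _)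
  have hsq : AntitoneOn (fun x => g x ^ 2) (Set.Icc a d) := by
    have hd : ∀ x ∈ Set.Ioo a d, HasDerivAt (fun x => g x ^ 2) (2 * (g x * g₁ x)) x := fun x hx =>
      ((hg x hx).pow 2).congr_deriv (by push_cast; ring)
    refine antitoneOn_of_deriv_nonpos (convex_Icc _ _) (by fun_prop) ?_ ?_
    all_goals
      rw [interior_Icc]
      intro x hx
    · exact (hd x hx).differentiableAt.differentiableWithinAt
    · rw [(hd x hx).deriv]
      linarith [hgg₁ x (Set.Ioo_subset_Icc_self hx)]
  -- If `g` is positive at `y` and negative later, it vanishes in between; since `g²` decreases, it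
  -- would then stay zero, so `g` is nonnegative on all of `[y, d]`, which `hpos` excludes.
  have hgneg : ∀ y ∈ Set.Ioo a d, g y ≤ 0 := by
    intro y hy
    by_contra! hgy
    refine hpos y hy hgy fun x hx => ?_
    by_contra! hgx
    have hsub : Set.Icc y x ⊆ Set.Icc a d := Set.Icc_subset_Icc hy.1.le hx.2
    obtain ⟨z, hz, hgz⟩ := intermediate_value_Icc' hx.1 (hgc.mono hsub)
      (show (0 : ℝ) ∈ Set.Icc (g x) (g y) from ⟨hgx.le, hgy.le⟩)
    have h := hsq (hsub hz) (hsub (Set.right_mem_Icc.mpr hx.1)) hz.2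
    simp only [hgz] at h
    nlinarith
  refine antitoneOn_of_deriv_nonpos (convex_Icc _ _) hφc ?_ ?_
  all_goals
    rw [interior_Icc]
    intro x hx
  · exact (hφ x hx).differentiableAt.differentiableWithinAt
  · rw [(hφ x hx).deriv]
    exact hgneg x hx

/-! ### Regularity and differential equations of the value functions -/

namespace PhaseTypeRisk

variable {n : ℕ}

/-- Below `y` the barrier enters only through the value at `y`. Hence, for two barriers at or above
`y` and the same `v`, a strict inequality at `y` carries over to every smaller surplus. -/
theorem toReal_stepOp_eq_exp_mul (M : PhaseTypeRisk n) {v : Fin n → ℝ → ENNReal} {K : ENNReal}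
    (b : Fin n → ℝ) (hv : ∀ i, Measurable (v i)) (hK : K ≠ ⊤)
    (hle : ∀ i x, v i x ≤ ENNReal.ofReal x + K)
    (i : Fin n) {x y : ℝ} (hx : 0 ≤ x) (hxy : x ≤ y) (hyb : y ≤ b i) :
    (M.stepOp b v i x).toReal = Real.exp ((M.exitRate i + M.δ) / M.c * x) *
      ((∫ s in x..y, Real.exp (-((M.exitRate i + M.δ) / M.c) * s) * M.jumpRate v i s) / M.c +
        Real.exp (-((M.exitRate i + M.δ) / M.c) * y) * (M.stepOp b v i y).toReal) := by
  have hint : ∀ a d, IntervalIntegrable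
      (fun s => Real.exp (-((M.exitRate i + M.δ) / M.c) * s) * M.jumpRate v i s) volume a d :=
    fun a d => (M.intervalIntegrable_jumpRate hv hK hle i a d).continuousOn_mul (by fun_prop)
  rw [M.toReal_stepOp_of_le_barrier b hv hK hle i hx (hxy.trans hyb),
    M.toReal_stepOp_of_le_barrier b hv hK hle i (hx.trans hxy) hyb,
    ← intervalIntegral.integral_add_adjacent_intervals (hint x y) (hint y (b i)),
    ← mul_assoc (Real.exp (-((M.exitRate i + M.δ) / M.c) * y)), ← Real.exp_add,
    neg_mul _ y, neg_add_cancel, Real.exp_zero]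
  ring

theorem stepOp_congr (M : PhaseTypeRisk n) {b b' : Fin n → ℝ} (v : Fin n → ℝ → ENNReal)
    {i : Fin n} (h : b i = b' i) (x : ℝ) : M.stepOp b v i x = M.stepOp b' v i x := by
  simp only [stepOp, reward, nextStay, h]

section Value

variable (M : PhaseTypeRisk n) {b : Fin n → ℝ}

theorem value_of_barrier_le (hb : ∀ i, 0 ≤ b i) (i : Fin n) {x : ℝ} (hx : b i ≤ x) :
    M.value b i x = x - b i +
      (M.c + M.jumpRate (M.expectedDividends b) i (b i)) / (M.exitRate i + M.δ) := by
  obtain ⟨K, hK, hle⟩ := M.exists_expectedDividends_le hb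
  rw [value, ← stepOp_expectedDividends]
  exact M.toReal_stepOp_of_barrier_le b (M.measurable_expectedDividends b) hK hle i
    ((hb i).trans hx) hx

theorem value_eq_exp_mul (hb : ∀ i, 0 ≤ b i) (i : Fin n) {x y : ℝ} (hx : 0 ≤ x) (hxy : x ≤ y)
    (hyb : y ≤ b i) : M.value b i x = Real.exp ((M.exitRate i + M.δ) / M.c * x) *
      ((∫ s in x..y, Real.exp (-((M.exitRate i + M.δ) / M.c) * s) *
        M.jumpRate (M.expectedDividends b) i s) / M.c +
        Real.exp (-((M.exitRate i + M.δ) / M.c) * y) * M.value b i y) := by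
  obtain ⟨K, hK, hle⟩ := M.exists_expectedDividends_le hb
  have h := M.toReal_stepOp_eq_exp_mul b (M.measurable_expectedDividends b) hK hle i hx hxy hyb
  simp only [stepOp_expectedDividends] at h
  exact h

theorem intervalIntegrable_exp_mul_jumpRate (hb : ∀ i, 0 ≤ b i) (i : Fin n) (r a d : ℝ) :
    IntervalIntegrable (fun s => Real.exp (r * s) * M.jumpRate (M.expectedDividends b) i s)
      volume a d := by
  obtain ⟨K, hK, hle⟩ := M.exists_expectedDividends_le hb
  exact (M.intervalIntegrable_jumpRate (M.measurable_expectedDividends b) hK hle i a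
    d).continuousOn_mul (by fun_prop)

theorem continuousOn_value (hb : ∀ i, 0 ≤ b i) (i : Fin n) :
    ContinuousOn (M.value b i) (Set.Ici 0) := by
  set Φ : ℝ → ℝ := fun x => Real.exp ((M.exitRate i + M.δ) / M.c * x) *
      (-(∫ s in b i..x, Real.exp (-((M.exitRate i + M.δ) / M.c) * s) *
        M.jumpRate (M.expectedDividends b) i s) / M.c +
        Real.exp (-((M.exitRate i + M.δ) / M.c) * b i) * M.value b i (b i)) with hΦ
  have hΦc : Continuous Φ := by
    have := intervalIntegral.continuous_primitive
      (M.intervalIntegrable_exp_mul_jumpRate hb i (-((M.exitRate i + M.δ) / M.c))) (b i)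
    fun_prop
  have hc : Continuous fun x => Φ (min x (b i)) + (x - min x (b i)) := by fun_prop
  refine hc.continuousOn.congr fun x hx => ?_
  have hΦv : ∀ y, 0 ≤ y → y ≤ b i → M.value b i y = Φ y := fun y hy hyb => by
    rw [M.value_eq_exp_mul hb i hy hyb le_rfl, hΦ, intervalIntegral.integral_symm]
  dsimp only
  rcases le_total x (b i) with h | h
  · rw [min_eq_left h, sub_self, add_zero, hΦv x hx h]
  · rw [min_eq_right h, ← hΦv (b i) (hb i) le_rfl, M.value_of_barrier_le hb i h,
      M.value_of_barrier_le hb i le_rfl]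
    ring

/-- The expected value right after a claim that hits the surplus `u`. -/
noncomputable def claimReal (M : PhaseTypeRisk n) (b : Fin n → ℝ) (u : ℝ) : ℝ :=
  (M.claimValue (M.expectedDividends b) u).toReal

theorem claimReal_eq (hb : ∀ i, 0 ≤ b i) {u : ℝ} (hu : 0 ≤ u) :
    M.claimReal b u = Real.exp (-(M.β * u)) *
      ∑ k, (M.init k).toReal * ∫ s in 0..u, M.β * Real.exp (M.β * s) * M.value b k s := by
  obtain ⟨K, hK, hle⟩ := M.exists_expectedDividends_le hb
  have h := M.exp_mul_toReal_claimValue (M.measurable_expectedDividends b) hK hle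
    (fun i x hx => M.expectedDividends_of_neg b i hx) hu
  simp only [value]
  rw [← h, ← mul_assoc, ← Real.exp_add, neg_add_cancel, Real.exp_zero, one_mul, claimReal]

theorem intervalIntegrable_exp_mul_value (hb : ∀ i, 0 ≤ b i) (i : Fin n) (a d : ℝ) :
    IntervalIntegrable (fun s => M.β * Real.exp (M.β * s) * M.value b i s) volume a d := by
  obtain ⟨K, hK, hle⟩ := M.exists_expectedDividends_le hb
  exact (intervalIntegrable_toReal (M.measurable_expectedDividends b) hK hle i a
    d).continuousOn_mul (by fun_prop)

theorem continuousOn_claimReal (hb : ∀ i, 0 ≤ b i) :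
    ContinuousOn (M.claimReal b) (Set.Ici 0) := by
  have hc : Continuous fun u => Real.exp (-(M.β * u)) *
      ∑ k, (M.init k).toReal * ∫ s in 0..u, M.β * Real.exp (M.β * s) * M.value b k s := by
    have := fun k => intervalIntegral.continuous_primitive
      (M.intervalIntegrable_exp_mul_value hb k) 0
    fun_prop
  exact hc.continuousOn.congr fun u hu => M.claimReal_eq hb hu

theorem hasDerivAt_claimReal (hb : ∀ i, 0 ≤ b i) {u : ℝ} (hu : 0 < u) :
    HasDerivAt (M.claimReal b)
      (M.β * (∑ k, (M.init k).toReal * M.value b k u - M.claimReal b u)) u := by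
  have hk : ∀ k, HasDerivAt (fun u => ∫ s in 0..u, M.β * Real.exp (M.β * s) * M.value b k s)
      (M.β * Real.exp (M.β * u) * M.value b k u) u := fun k => by
    have hm : Measurable fun s => M.β * Real.exp (M.β * s) * M.value b k s :=
      Measurable.mul (by fun_prop) (M.measurable_expectedDividends b k).ennreal_toReal
    refine intervalIntegral.integral_hasDerivAt_right (M.intervalIntegrable_exp_mul_value hb k 0 u)
      hm.stronglyMeasurable.stronglyMeasurableAtFilter ?_
    have := (M.continuousOn_value hb k).continuousAt (Ici_mem_nhds hu)
    fun_prop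
  have hsum := HasDerivAt.fun_sum (u := Finset.univ) fun k _ => (hk k).const_mul (M.init k).toReal
  have he : HasDerivAt (fun u : ℝ => Real.exp (-(M.β * u))) (Real.exp (-(M.β * u)) * -(M.β * 1)) u :=
    (((hasDerivAt_id u).const_mul M.β).neg).exp
  refine ((he.mul hsum).congr_of_eventuallyEq ?_).congr_deriv ?_
  · filter_upwards [Ici_mem_nhds hu] with w hw
    rw [M.claimReal_eq hb hw, Pi.mul_apply]
  · rw [M.claimReal_eq hb hu.le]
    have hexp : Real.exp (-(M.β * u)) * Real.exp (M.β * u) = 1 := by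
      rw [← Real.exp_add, neg_add_cancel, Real.exp_zero]
    have h2 : ∑ k, (M.init k).toReal * (M.β * Real.exp (M.β * u) * M.value b k u) =
        M.β * Real.exp (M.β * u) * ∑ k, (M.init k).toReal * M.value b k u := by
      rw [Finset.mul_sum]
      exact Finset.sum_congr rfl fun k _ => by ring
    rw [h2]
    linear_combination M.β * (∑ k, (M.init k).toReal * M.value b k u) * hexp

theorem jumpRate_expectedDividends (hb : ∀ i, 0 ≤ b i) (i : Fin n) (u : ℝ) :
    M.jumpRate (M.expectedDividends b) i u =
      (∑ j : Fin n, (if j = i then 0 else M.rate i j.castSucc) * M.value b j u) +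
      M.rate i (Fin.last n) * M.claimReal b u := by
  obtain ⟨K, hK, hle⟩ := M.exists_expectedDividends_le hb
  exact M.jumpRate_eq_sum hK hle i u

theorem continuousOn_jumpRate (hb : ∀ i, 0 ≤ b i) (i : Fin n) :
    ContinuousOn (M.jumpRate (M.expectedDividends b) i) (Set.Ici 0) := by
  have h := M.continuousOn_claimReal hb
  have h2 := M.continuousOn_value hb
  simp only [funext (M.jumpRate_expectedDividends hb i)]
  fun_prop

theorem hasDerivAt_value (hb : ∀ i, 0 ≤ b i) (i : Fin n) {x : ℝ} (hx : 0 < x) (hxb : x < b i) :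
    HasDerivAt (M.value b i) (((M.exitRate i + M.δ) * M.value b i x -
      M.jumpRate (M.expectedDividends b) i x) / M.c) x := by
  have hc := M.c_pos
  set κ := (M.exitRate i + M.δ) / M.c with hκ
  have hm : Measurable fun s => Real.exp (-κ * s) * M.jumpRate (M.expectedDividends b) i s :=
    Measurable.mul (by fun_prop) (M.measurable_jumpRate (M.measurable_expectedDividends b) i)
  have hcont : ContinuousAt
      (fun s => Real.exp (-κ * s) * M.jumpRate (M.expectedDividends b) i s) x := by
    have := (M.continuousOn_jumpRate hb i).continuousAt (Ici_mem_nhds hx)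
    fun_prop
  have hI := intervalIntegral.integral_hasDerivAt_left
    (M.intervalIntegrable_exp_mul_jumpRate hb i (-κ) x (b i))
    hm.stronglyMeasurable.stronglyMeasurableAtFilter hcont
  have he : HasDerivAt (fun x : ℝ => Real.exp (κ * x)) (Real.exp (κ * x) * (κ * 1)) x :=
    ((hasDerivAt_id x).const_mul κ).exp
  refine ((he.mul ((hI.div_const M.c).add_const
    (Real.exp (-κ * b i) * M.value b i (b i)))).congr_of_eventuallyEq ?_).congr_deriv ?_
  · filter_upwards [Ioo_mem_nhds hx hxb] with y hy
    rw [M.value_eq_exp_mul hb i hy.1.le hy.2.le le_rfl, Pi.mul_apply]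
  · rw [M.value_eq_exp_mul hb i hx.le hxb.le le_rfl, ← hκ]
    have hexp : Real.exp (κ * x) * Real.exp (-κ * x) = 1 := by
      rw [← Real.exp_add, neg_mul, add_neg_cancel, Real.exp_zero]
    have hq : M.exitRate i + M.δ = κ * M.c := by rw [hκ]; field_simp
    rw [hq]
    rw [neg_mul] at hexp ⊢
    field_simp
    linear_combination (-M.jumpRate (M.expectedDividends b) i x) * hexp

end Value

theorem hasDerivAt_value_of_barrier_lt (M : PhaseTypeRisk n) {b : Fin n → ℝ} (hb : ∀ i, 0 ≤ b i)
    (i : Fin n) {x : ℝ} (hx : b i < x) : HasDerivAt (M.value b i) 1 x := by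
  refine (((hasDerivAt_id x).sub_const (b i)).add_const
    ((M.c + M.jumpRate (M.expectedDividends b) i (b i)) /
      (M.exitRate i + M.δ))).congr_of_eventuallyEq ?_
  filter_upwards [Ioi_mem_nhds hx] with y hy
  exact M.value_of_barrier_le hb i (le_of_lt hy)

theorem value_barrier (M : PhaseTypeRisk n) {b : Fin n → ℝ} (hb : ∀ i, 0 ≤ b i) (i : Fin n) :
    (M.exitRate i + M.δ) * M.value b i (b i) =
      M.c + M.jumpRate (M.expectedDividends b) i (b i) := by
  have hq : 0 < M.exitRate i + M.δ := add_pos (M.exitRate_pos i) M.δ_pos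
  rw [M.value_of_barrier_le hb i le_rfl]
  field_simp
  ring

theorem value_eq_value_add (M : PhaseTypeRisk n) {b : Fin n → ℝ} (hb : ∀ i, 0 ≤ b i) (i : Fin n)
    {x y : ℝ} (hx : b i ≤ x) (hy : b i ≤ y) : M.value b i x = M.value b i y + (x - y) := by
  rw [M.value_of_barrier_le hb i hx, M.value_of_barrier_le hb i hy]
  ring

/-- Smooth fit, for every positive barrier and without optimality: at the barrier all premiums are
paid out, and the resulting balance `value_barrier` makes the differential equation below it yield
slope 1 in the limit. -/
theorem hasDerivAt_value_barrier (M : PhaseTypeRisk n) {b : Fin n → ℝ} (hb : ∀ i, 0 ≤ b i)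
    (i : Fin n) (hbi : 0 < b i) : HasDerivAt (M.value b i) 1 (b i) := by
  have hc := M.c_pos
  have hleft : HasDerivWithinAt (M.value b i) 1 (Set.Iic (b i)) (b i) := by
    refine hasDerivWithinAt_Iic_of_tendsto_deriv (s := Set.Ioo 0 (b i)) ?_ ?_
      (Ioo_mem_nhdsLT hbi) ?_
    · exact fun x hx => (M.hasDerivAt_value hb i hx.1
        hx.2).differentiableAt.differentiableWithinAt
    · exact ((M.continuousOn_value hb i) (b i) (hb i)).mono fun x hx => hx.1.le
    · have h1 := (M.continuousOn_value hb i).continuousAt (Ici_mem_nhds hbi)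
      have h2 := (M.continuousOn_jumpRate hb i).continuousAt (Ici_mem_nhds hbi)
      have h3 : ContinuousAt (fun x => ((M.exitRate i + M.δ) * M.value b i x -
          M.jumpRate (M.expectedDividends b) i x) / M.c) (b i) := by fun_prop
      have h4 : ((M.exitRate i + M.δ) * M.value b i (b i) -
          M.jumpRate (M.expectedDividends b) i (b i)) / M.c = 1 := by
        rw [M.value_barrier hb i, add_sub_cancel_right, div_self hc.ne']
      have h5 := h3.tendsto.mono_left (nhdsWithin_le_nhds (s := Set.Iio (b i)))
      rw [h4] at h5
      refine h5.congr' ?_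
      filter_upwards [Ioo_mem_nhdsLT hbi] with x hx
      exact (M.hasDerivAt_value hb i hx.1 hx.2).deriv.symm
  have hright : HasDerivWithinAt (M.value b i) 1 (Set.Ici (b i)) (b i) := by
    have h : HasDerivWithinAt (fun x => M.value b i (b i) + (x - b i)) 1 (Set.Ici (b i)) (b i) :=
      (((hasDerivAt_id (b i)).sub_const (b i)).const_add _).hasDerivWithinAt
    exact h.congr (fun x hx => M.value_eq_value_add hb i hx le_rfl) (by simp)
  have h := hleft.union hright
  rwa [Set.Iic_union_Ici, hasDerivWithinAt_univ] at h

/-! ### Consequences of optimality: lowering and raising one barrier -/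

/-- Changing one of several optimal barriers during one stay cannot be a strict improvement. -/
theorem IsOptimalBarrier.not_forall_lt_stepOp_update {M : PhaseTypeRisk n} {b : Fin n → ℝ}
    (hopt : M.IsOptimalBarrier b) {i : Fin n} (hbi : 0 < b i) {y : ℝ} (hy : 0 ≤ y) :
    ¬ ∀ x, 0 ≤ x → M.value b i x <
      (M.stepOp (Function.update b i y) (M.expectedDividends b) i x).toReal := by
  intro h
  have hlt : ∀ x, 0 ≤ x → M.expectedDividends b i x <
      M.stepOp (Function.update b i y) (M.expectedDividends b) i x := fun x hx => by
    by_contra! hle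
    exact absurd (h x hx)
      (not_lt.mpr (ENNReal.toReal_mono (M.expectedDividends_ne_top hopt.1 i x) hle))
  refine hopt.not_lt_stepOp (b' := Function.update b i y) (fun j => ?_) (fun j x hx => ?_)
    le_rfl hbi (hlt 0 le_rfl)
  · by_cases hj : j = i
    · subst hj; simpa using hy
    · simpa [hj] using hopt.1 j
  · by_cases hj : j = i
    · subst hj; exact (hlt x hx).le
    · rw [M.stepOp_congr (b := Function.update b i y) (b' := b) _ (by simp [hj]),
        stepOp_expectedDividends]

/-- The quotient is the slope of the value function. If it were below 1 at `y`, lowering the barrier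
to `y` for one stay would gain at `y`. The gain persists above, where the new slope is 1 and the old
at most 1, and is transported below by `toReal_stepOp_eq_exp_mul`. -/
theorem IsOptimalBarrier.one_le_of_forall_le_one {M : PhaseTypeRisk n} {b : Fin n → ℝ}
    (hopt : M.IsOptimalBarrier b) {i : Fin n} {y : ℝ} (hy : 0 < y) (hyb : y < b i)
    (h : ∀ x ∈ Set.Icc y (b i), ((M.exitRate i + M.δ) * M.value b i x -
      M.jumpRate (M.expectedDividends b) i x) / M.c ≤ 1) :
    1 ≤ ((M.exitRate i + M.δ) * M.value b i y -
      M.jumpRate (M.expectedDividends b) i y) / M.c := by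
  have hb := hopt.1
  have hc := M.c_pos
  have hq : 0 < M.exitRate i + M.δ := add_pos (M.exitRate_pos i) M.δ_pos
  obtain ⟨K, hK, hle⟩ := M.exists_expectedDividends_le hb
  by_contra! hlt
  rw [div_lt_one hc] at hlt
  have hlt' : M.value b i y <
      (M.c + M.jumpRate (M.expectedDividends b) i y) / (M.exitRate i + M.δ) := by
    rw [lt_div_iff₀ hq]
    linarith
  have hW : ∀ x, y ≤ x → (M.stepOp (Function.update b i y) (M.expectedDividends b) i x).toReal =
      x - y + (M.c + M.jumpRate (M.expectedDividends b) i y) / (M.exitRate i + M.δ) := fun x hx => by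
    rw [M.toReal_stepOp_of_barrier_le _ (M.measurable_expectedDividends b) hK hle i
      (hy.le.trans hx) (by simpa using hx), Function.update_self]
  have hslope : ∀ x ∈ Set.Icc y (b i), M.value b i x - M.value b i y ≤ x - y := fun x hx => by
    have := (convex_Icc y (b i)).image_sub_le_mul_sub_of_deriv_le (C := 1)
      ((M.continuousOn_value hb i).mono fun z hz => hy.le.trans hz.1)
      (fun z hz => by
        rw [interior_Icc] at hz
        exact (M.hasDerivAt_value hb i (hy.trans hz.1)
          hz.2).differentiableAt.differentiableWithinAt)
      (fun z hz => by
        rw [interior_Icc] at hz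
        rw [(M.hasDerivAt_value hb i (hy.trans hz.1) hz.2).deriv]
        exact h z ⟨hz.1.le, hz.2.le⟩)
      y (Set.left_mem_Icc.mpr hyb.le) x hx hx.1
    linarith
  refine hopt.not_forall_lt_stepOp_update (hy.trans hyb) hy.le fun x hx => ?_
  rcases le_total x y with hxy | hxy
  · rw [M.toReal_stepOp_eq_exp_mul _ (M.measurable_expectedDividends b) hK hle i hx hxy (by simp),
      M.value_eq_exp_mul hb i hx hxy hyb.le, hW y le_rfl, sub_self, zero_add]
    gcongr
  · rw [hW x hxy]
    rcases le_total x (b i) with hxb | hxb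
    · linarith [hslope x ⟨hxy, hxb⟩]
    · linarith [hslope (b i) ⟨hyb.le, le_rfl⟩, M.value_eq_value_add hb i hxb le_rfl]

/-- The expression is the rate of gain from paying out at the surplus `x` during a stay, relative to
the current value. If it were positive at `y`, raising the barrier to `y` for one stay would be
strictly better at `y`, and its nonnegativity in between carries the gain down to `b i`, hence
everywhere. -/
theorem IsOptimalBarrier.nonpos_of_forall_nonneg {M : PhaseTypeRisk n} {b : Fin n → ℝ}
    (hopt : M.IsOptimalBarrier b) {i : Fin n} (hbi : 0 < b i) {y : ℝ} (hyb : b i ≤ y)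
    (h : ∀ x ∈ Set.Icc (b i) y, 0 ≤ M.c - (M.exitRate i + M.δ) * M.value b i x +
      M.jumpRate (M.expectedDividends b) i x) :
    M.c - (M.exitRate i + M.δ) * M.value b i y + M.jumpRate (M.expectedDividends b) i y ≤ 0 := by
  have hb := hopt.1
  have hc := M.c_pos
  have hq : 0 < M.exitRate i + M.δ := add_pos (M.exitRate_pos i) M.δ_pos
  obtain ⟨K, hK, hle⟩ := M.exists_expectedDividends_le hb
  by_contra! hlt
  have hlt' : M.value b i y <
      (M.c + M.jumpRate (M.expectedDividends b) i y) / (M.exitRate i + M.δ) := by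
    rw [lt_div_iff₀ hq]
    linarith
  have hy := (hb i).trans hyb
  have hW : ∀ x, y ≤ x → (M.stepOp (Function.update b i y) (M.expectedDividends b) i x).toReal =
      x - y + (M.c + M.jumpRate (M.expectedDividends b) i y) / (M.exitRate i + M.δ) := fun x hx => by
    rw [M.toReal_stepOp_of_barrier_le _ (M.measurable_expectedDividends b) hK hle i
      (hy.trans hx) (by simpa using hx), Function.update_self]
  have hW' := fun (x z : ℝ) (hx : 0 ≤ x) (hxz : x ≤ z) (hzy : z ≤ y) =>
    M.toReal_stepOp_eq_exp_mul (Function.update b i y) (M.measurable_expectedDividends b) hK hle i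
      hx hxz (by simpa using hzy)
  set κ := (M.exitRate i + M.δ) / M.c with hκ
  have hmid : ∀ x, b i ≤ x → x ≤ y → M.value b i x <
      (M.stepOp (Function.update b i y) (M.expectedDividends b) i x).toReal := by
    intro x hbx hxy
    -- Above its barrier the value has slope 1. So it satisfies the same type of integral equation
    -- as the deviation, with `κ f - 1` in place of `M.jumpRate / M.c`, and the hypothesis `h`
    -- compares these two.
    have hftc : ∫ s in x..y, Real.exp (-κ * s) * (κ * M.value b i s - 1) =
        Real.exp (-κ * x) * M.value b i x - Real.exp (-κ * y) * M.value b i y := by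
      have hcont : ContinuousOn (M.value b i) (Set.uIcc x y) :=
        (M.continuousOn_value hb i).mono fun s hs => by
          rw [Set.uIcc_of_le hxy] at hs
          exact (hb i).trans (hbx.trans hs.1)
      have := intervalIntegral.integral_eq_sub_of_hasDeriv_right (a := x) (b := y)
        (f := fun s => -(Real.exp (-κ * s) * M.value b i s))
        (f' := fun s => Real.exp (-κ * s) * (κ * M.value b i s - 1)) (by fun_prop)
        (fun s hs => by
          rw [min_eq_left hxy, max_eq_right hxy] at hs
          have he : HasDerivAt (fun s : ℝ => Real.exp (-κ * s)) (Real.exp (-κ * s) * (-κ * 1)) s :=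
            ((hasDerivAt_id s).const_mul (-κ)).exp
          refine HasDerivAt.hasDerivWithinAt ?_
          refine (he.mul (M.hasDerivAt_value_of_barrier_lt hb i
            (hbx.trans_lt hs.1))).neg.congr_deriv ?_
          ring)
        (ContinuousOn.intervalIntegrable (by fun_prop))
      rw [this]
      ring
    have hint : ∫ s in x..y, Real.exp (-κ * s) * (κ * M.value b i s - 1) ≤
        (∫ s in x..y, Real.exp (-κ * s) * M.jumpRate (M.expectedDividends b) i s) / M.c := by
      rw [← intervalIntegral.integral_div]
      refine intervalIntegral.integral_mono_on hxy ?_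
        ((M.intervalIntegrable_exp_mul_jumpRate hb i (-κ) x y).div_const _) fun s hs => ?_
      · have hcont : ContinuousOn (M.value b i) (Set.uIcc x y) :=
          (M.continuousOn_value hb i).mono fun s hs => by
            rw [Set.uIcc_of_le hxy] at hs
            exact (hb i).trans (hbx.trans hs.1)
        exact ContinuousOn.intervalIntegrable (by fun_prop)
      · rw [mul_div_assoc]
        refine mul_le_mul_of_nonneg_left ?_ (Real.exp_nonneg _)
        have := h s ⟨hbx.trans hs.1, hs.2⟩
        rw [le_div_iff₀ hc, hκ]
        field_simp
        linarith
    rw [hW' x y ((hb i).trans hbx) hxy le_rfl, hW y le_rfl, sub_self, zero_add]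
    have hexp : Real.exp (κ * x) * Real.exp (-κ * x) = 1 := by
      rw [← Real.exp_add, neg_mul, add_neg_cancel, Real.exp_zero]
    calc M.value b i x = Real.exp (κ * x) * (Real.exp (-κ * x) * M.value b i x) := by
          rw [← mul_assoc, hexp, one_mul]
      _ < _ := by
          refine mul_lt_mul_of_pos_left ?_ (Real.exp_pos _)
          have := mul_lt_mul_of_pos_left hlt' (Real.exp_pos (-κ * y))
          linarith
  refine hopt.not_forall_lt_stepOp_update hbi hy fun x hx => ?_
  rcases le_total x (b i) with hxb | hxb
  · rw [hW' x (b i) hx hxb hyb, M.value_eq_exp_mul hb i hx hxb le_rfl, ← hκ]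
    have := hmid (b i) le_rfl hyb
    gcongr
  · rcases le_total x y with hxy | hxy
    · exact hmid x hxb hxy
    · rw [hW x hxy, M.value_eq_value_add hb i hxb hyb]
      linarith

end PhaseTypeRisk

/-! ### Concavity in the second phase -/

open PhaseTypeRisk in
theorem mainTheorem1 (M : PhaseTypeRisk 2) (b : Fin 2 → ℝ) (hb : M.IsOptimalBarrier b)
    (hb₀ : 0 < b 0) (hb₁ : b 0 < b 1) :
    (∀ x, M.expectedDividends b 1 x ≠ ⊤) ∧ ConcaveOn ℝ (Set.Ici (b 0)) (M.value b 1) := by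
  refine ⟨M.expectedDividends_ne_top hb.1 1, ?_⟩
  have hnn := hb.1
  have hc := M.c_pos
  have hδ := M.δ_pos
  have hb1 : 0 < b 1 := hb₀.trans hb₁
  set h := M.jumpRate (M.expectedDividends b) 1 with hh
  set q := M.exitRate 1 + M.δ with hq
  set l := M.rate 1 (Fin.castSucc 0) with hl
  set k := M.rate 1 (Fin.last 2) with hk
  set p₁ := (M.init 0).toReal with hp₁
  set p₂ := (M.init 1).toReal with hp₂
  set φ : ℝ → ℝ := fun x => (q * M.value b 1 x - h x) / M.c with hφdef
  set γ : ℝ → ℝ := fun x => M.β * (p₁ * M.value b 0 x + p₂ * M.value b 1 x - M.claimReal b x)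
    with hγdef
  have hhx : ∀ x, h x = l * M.value b 0 x + k * M.claimReal b x := fun x => by
    rw [hh, M.jumpRate_expectedDividends hnn 1 x]
    simp [hl, hk]
  have hG : ∀ x, 0 < x → HasDerivAt (M.claimReal b) (γ x) x := fun x hx => by
    have := M.hasDerivAt_claimReal hnn hx
    rwa [Fin.sum_univ_two] at this
  have hf₀c := M.continuousOn_value hnn 0
  have hf₁c := M.continuousOn_value hnn 1
  have hhc : ContinuousOn h (Set.Ici 0) := M.continuousOn_jumpRate hnn 1
  have hGc := M.continuousOn_claimReal hnn
  have hφc : ContinuousOn φ (Set.Ici 0) := by fun_prop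
  have hγc : ContinuousOn γ (Set.Ici 0) := by fun_prop
  have hf₀ : ∀ x, b 0 < x → HasDerivAt (M.value b 0) 1 x := fun x hx =>
    M.hasDerivAt_value_of_barrier_lt hnn 0 hx
  have hf₁ : ∀ x ∈ Set.Ioo (b 0) (b 1), HasDerivAt (M.value b 1) (φ x) x := fun x hx =>
    M.hasDerivAt_value hnn 1 (hb₀.trans hx.1) hx.2
  have hh' : ∀ x, b 0 < x → HasDerivAt h (l + k * γ x) x := fun x hx => by
    rw [funext hhx]
    exact (((hf₀ x hx).const_mul l).add ((hG x (hb₀.trans hx)).const_mul k)).congr_deriv (by ring)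
  have hφb : φ (b 1) = 1 := by
    simp only [hφdef]
    rw [hq, M.value_barrier hnn 1, add_sub_cancel_right, div_self hc.ne']
  -- The exit rate of phase `1` equals `l + k` by the zero row sum, so `k * p₂ ≤ k ≤ l + k ≤ q`.
  have hkq : k * p₂ ≤ q := by
    have hl0 : 0 ≤ l := M.rate_nonneg 1 _ (by decide)
    have hk0 : 0 ≤ k := M.rate_nonneg 1 _ (by decide)
    have hsum := M.rate_row_sum 1
    rw [Fin.sum_univ_castSucc, Fin.sum_univ_two] at hsum
    have hp : p₂ ≤ 1 := ENNReal.toReal_le_of_le_ofReal zero_le_one (by simpa using M.init.coe_le_one 1)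
    have hex : M.exitRate 1 = -M.rate 1 (Fin.castSucc 1) := rfl
    have : k * p₂ ≤ k := mul_le_of_le_one_right hk0 hp
    linarith
  have hanti : AntitoneOn φ (Set.Icc (b 0) (b 1)) := by
    have hsub : Set.Icc (b 0) (b 1) ⊆ Set.Ici 0 := fun x hx => hb₀.le.trans hx.1
    refine antitoneOn_of_linear_system (γ := γ) (p₁ := p₁) (l := l) hc M.β_pos hb₁ hkq
      (hφc.mono hsub) (hγc.mono hsub) ?_ ?_ hφb ?_ ?_
    · exact fun x hx => ((((hf₁ x hx).const_mul q).sub (hh' x hx.1)).div_const M.c).congr_deriv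
        (by rw [sub_sub])
    · exact fun x hx => (((((hf₀ x hx.1).const_mul p₁).add ((hf₁ x hx).const_mul p₂)).sub
        (hG x (hb₀.trans hx.1))).const_mul M.β).congr_deriv (by rw [mul_one])
    · exact fun y hy hle => hb.one_le_of_forall_le_one (hb₀.trans hy.1) hy.2 hle
    -- Above `b 1` both values have slope 1, so `-(q - l - k γ)` is the derivative of the gain `R`
    -- used in the raising condition. A negative sign at `b 1` makes `R` increase strictly from 0
    -- just above the barrier, and raising the barrier would pay.
    · by_contra! hneg
      have hev : ∀ᶠ x in nhds (b 1), q - l - k * γ x < 0 := by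
        have hγat := hγc.continuousAt (Ici_mem_nhds hb1)
        have : ContinuousAt (fun x => q - l - k * γ x) (b 1) := by fun_prop
        exact this.eventually (gt_mem_nhds hneg)
      obtain ⟨y, hy, hyb⟩ := mem_nhdsGE_iff_exists_Icc_subset.mp (nhdsWithin_le_nhds hev :
        {x | q - l - k * γ x < 0} ∈ nhdsWithin (b 1) (Set.Ici (b 1)))
      set R : ℝ → ℝ := fun x => M.c - q * M.value b 1 x + h x with hR
      have hsub' : Set.Icc (b 1) y ⊆ Set.Ici 0 := fun x hx => hb1.le.trans hx.1
      have hRmono : StrictMonoOn R (Set.Icc (b 1) y) := by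
        refine strictMonoOn_of_deriv_pos (convex_Icc _ _)
          (ContinuousOn.mono (by fun_prop) hsub') fun x hx => ?_
        rw [interior_Icc] at hx
        have hd : HasDerivAt R (-(q * 1) + (l + k * γ x)) x :=
          (((M.hasDerivAt_value_of_barrier_lt hnn 1 hx.1).const_mul q).const_sub M.c).add
            (hh' x (hb₁.trans hx.1))
        rw [hd.deriv]
        have : q - l - k * γ x < 0 := hyb ⟨hx.1.le, hx.2.le⟩
        linarith
      have hR0 : R (b 1) = 0 := by
        simp only [hR]
        rw [hq, M.value_barrier hnn 1, ← hh]
        ring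
      have hleft : b 1 ∈ Set.Icc (b 1) y := Set.left_mem_Icc.mpr (le_of_lt hy)
      have hRy : R y ≤ 0 := hb.nonpos_of_forall_nonneg hb1 (le_of_lt hy) fun x hx =>
        hR0 ▸ hRmono.monotoneOn hleft hx hx.1
      have := hRmono hleft (Set.right_mem_Icc.mpr (le_of_lt hy)) hy
      linarith
  -- Freezing `φ` at the barrier, where it equals 1, gives the derivative on the whole half-line; it
  -- is antitone because `φ` is.
  have hd : ∀ x, b 0 < x → HasDerivAt (M.value b 1) (φ (min x (b 1))) x := by
    intro x hx
    rcases lt_trichotomy x (b 1) with hlt | heq | hgt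
    · rw [min_eq_left hlt.le]
      exact hf₁ x ⟨hx, hlt⟩
    · rw [heq, min_self, hφb]
      exact M.hasDerivAt_value_barrier hnn 1 hb1
    · rw [min_eq_right hgt.le, hφb]
      exact M.hasDerivAt_value_of_barrier_lt hnn 1 hgt
  refine AntitoneOn.concaveOn_of_deriv (convex_Ici _)
    (hf₁c.mono (Set.Ici_subset_Ici.mpr hb₀.le)) ?_ ?_
  all_goals rw [interior_Ici]
  · exact fun x hx => (hd x hx).differentiableAt.differentiableWithinAt
  · intro x hx y hy hxy
    rw [(hd x hx).deriv, (hd y hy).deriv]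
    exact hanti ⟨le_min (le_of_lt hx) hb₁.le, min_le_right _ _⟩
      ⟨le_min (le_of_lt hy) hb₁.le, min_le_right _ _⟩ (min_le_min_right _ hxy)
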